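/- Let $\mathbb{H}^2$ be the hyperbolic plane, modelled as the unit disc with the metric $\sigma^2|dz|^2$, $\sigma(z)=\frac{2}{1-|z|^2}$, and give $\mathbb{H}^2\times\mathbb{R}$ the product metric $\sigma^2|dz|^2+dt^2$. Let $\Omega\subset\mathbb{C}$ be a nonempty connected open set and let $X=(h,f):\Omega\to\mathbb{H}^2\times\mathbb{R}$ be a smooth conformal immersion that is minimal (its mean curvature vector vanishes identically). Let $\lambda^2|dw|^2$ be the induced metric and $K=-\lambda^{-2}\Delta\log\lambda$ its (intrinsic) Gauss curvature, where $\Delta$ is the Euclidean Laplacian. 1. If $w\in\Omega$ and $K(w)=0$, then the tangent plane of $X$ at $X(w)$ is vertical, that is, $\partial_t\in dX_w(\mathbb{R}^2)$. 2. If $K\equiv 0$ on $\Omega$, then $X(\Omega)$ is contained in a vertical cylinder over a geodesic: there is a complete geodesic $\Gamma\subset\mathbb{H}^2$ such that $X(\Omega)\subset\Gamma\times\mathbb{R}$. -/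

import Mathlib

noncomputable section

open scoped ContDiff ComplexConjugate

namespace H2R

/-- Conformal factor of the Poincare disc: the hyperbolic metric of the open unit disc of `ℂ`
is `σ² |dz|²`, with constant curvature `-1`. -/
def sigma (z : ℂ) : ℝ := 2 / (1 - ‖z‖ ^ 2)

/-- The hyperbolic plane (disc model), as a subset of `ℂ`. -/
def disc : Set ℂ := Metric.ball 0 1

/-- The product metric `σ² |dz|² + dt²` of `ℍ² × ℝ` at the point `p`, on the coordinate vectors
`a b : ℂ × ℝ`. -/
def metric (p a b : ℂ × ℝ) : ℝ := sigma p.1 ^ 2 * (a.1 * conj b.1).re + a.2 * b.2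

/-- Christoffel symbols `2 (log σ)_z a b` of the hyperbolic metric on the disc. -/
def christoffelDisc (z a b : ℂ) : ℂ := (2 * conj z / (1 - (‖z‖ : ℂ) ^ 2)) * a * b

/-- Christoffel symbols of `ℍ² × ℝ`: in coordinates the Levi-Civita connection is
`∇_a V = D_a V + Γ(a, V)`. -/
def christoffel (p a b : ℂ × ℝ) : ℂ × ℝ := (christoffelDisc p.1 a.1 b.1, 0)

/-- The connection is torsion free. -/
theorem christoffel_symm (p a b : ℂ × ℝ) : christoffel p a b = christoffel p b a := by
  simp only [christoffel, christoffelDisc, Prod.mk.injEq, and_true]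
  ring

/-- The connection is compatible with the metric (`D_a ⟨b, c⟩ = ⟨Γ(a, b), c⟩ + ⟨b, Γ(a, c)⟩` for
constant coordinate vectors); together with `christoffel_symm` this
characterizes the Levi-Civita connection. -/
theorem metric_compat (p : ℂ × ℝ) (hp : p.1 ∈ disc) (a b c : ℂ × ℝ) :
    HasDerivAt (fun t : ℝ => metric (p + t • a) b c)
      (metric p (christoffel p a b) c + metric p b (christoffel p a c)) 0 := by
  obtain ⟨z, t⟩ := p
  obtain ⟨x, y⟩ := z
  have hz : x ^ 2 + y ^ 2 < 1 := by
    have h1 : ‖(⟨x, y⟩ : ℂ)‖ < 1 := by simpa [disc] using hp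
    have h2 : ‖(⟨x, y⟩ : ℂ)‖ ^ 2 < 1 := by nlinarith [norm_nonneg (⟨x, y⟩ : ℂ)]
    rw [Complex.sq_norm, Complex.normSq_mk] at h2
    nlinarith
  have hne : 1 - (x ^ 2 + y ^ 2) ≠ 0 := by linarith
  have hq : HasDerivAt (fun s : ℝ => 1 - ((x + s * a.1.re) ^ 2 + (y + s * a.1.im) ^ 2))
      (-(2 * x * a.1.re + 2 * y * a.1.im)) 0 := by
    have h1 : HasDerivAt (fun s : ℝ => x + s * a.1.re) a.1.re 0 := by
      simpa using ((hasDerivAt_id (0 : ℝ)).mul_const a.1.re).const_add x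
    have h2 : HasDerivAt (fun s : ℝ => y + s * a.1.im) a.1.im 0 := by
      simpa using ((hasDerivAt_id (0 : ℝ)).mul_const a.1.im).const_add y
    refine (((h1.pow 2).add (h2.pow 2)).const_sub 1).congr_deriv ?_
    simp
  have hs := (((hasDerivAt_const (0 : ℝ) (2 : ℝ)).div hq (by simpa using hne)).pow 2).mul_const
    ((b.1 * conj c.1).re) |>.add_const (b.2 * c.2)
  have hfun : (fun s : ℝ => metric (((⟨x, y⟩ : ℂ), t) + s • a) b c) = fun s : ℝ =>
      (2 / (1 - ((x + s * a.1.re) ^ 2 + (y + s * a.1.im) ^ 2))) ^ 2 * (b.1 * conj c.1).re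
        + b.2 * c.2 := by
    funext s
    simp only [metric, sigma, Complex.sq_norm, Complex.normSq_apply, Prod.fst_add, Prod.smul_fst,
      Complex.add_re, Complex.add_im, Complex.real_smul, Complex.re_ofReal_mul,
      Complex.im_ofReal_mul, ← sq]
  rw [hfun]
  refine hs.congr_deriv ?_
  have hk : (2 * conj (⟨x, y⟩ : ℂ) / (1 - (‖(⟨x, y⟩ : ℂ)‖ : ℂ) ^ 2)) =
      ⟨2 * x / (1 - (x ^ 2 + y ^ 2)), -(2 * y) / (1 - (x ^ 2 + y ^ 2))⟩ := by
    have : (1 - (‖(⟨x, y⟩ : ℂ)‖ : ℂ) ^ 2) = ((1 - (x ^ 2 + y ^ 2) : ℝ) : ℂ) := by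
      rw [← Complex.ofReal_pow, Complex.sq_norm, Complex.normSq_mk]
      push_cast
      ring
    rw [this]
    apply Complex.ext
    · rw [Complex.div_ofReal_re]; simp
    · rw [Complex.div_ofReal_im]; simp
  simp only [metric, christoffel, christoffelDisc, hk, sigma, Complex.sq_norm,
    Complex.normSq_mk, Complex.mul_re, Complex.mul_im, Complex.conj_re, Complex.conj_im, ← sq]
  simp
  field_simp
  ring

/-- First fundamental form (induced metric) of `X : ℂ → ℍ² × ℝ` at `w`. -/
def firstForm (X : ℂ → ℂ × ℝ) (w a b : ℂ) : ℝ :=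
  metric (X w) (fderiv ℝ X w a) (fderiv ℝ X w b)

/-- `X = (h, f) : Ω → ℍ² × ℝ` is a smooth conformal immersion: with `w = u + i v`, the vectors
`X_u` and `X_v` are linearly independent, have equal length, and are orthogonal. -/
structure IsConformalImmersion (X : ℂ → ℂ × ℝ) (Ω : Set ℂ) : Prop where
  smooth : ContDiffOn ℝ ∞ X Ω
  mapsTo : ∀ w ∈ Ω, (X w).1 ∈ disc
  immersion : ∀ w ∈ Ω, Function.Injective (fderiv ℝ X w)
  equal_length : ∀ w ∈ Ω, firstForm X w 1 1 = firstForm X w Complex.I Complex.I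
  orthogonal : ∀ w ∈ Ω, firstForm X w 1 Complex.I = 0

/-- Covariant derivative `∇_a (dX b)` in `ℍ² × ℝ` along `X`, for constant `a b : ℂ`. -/
def covDeriv (X : ℂ → ℂ × ℝ) (w a b : ℂ) : ℂ × ℝ :=
  fderiv ℝ (fderiv ℝ X) w a b + christoffel (X w) (fderiv ℝ X w a) (fderiv ℝ X w b)

/-- Determinant `E G - F²` of the first fundamental form. -/
def firstFormDet (X : ℂ → ℂ × ℝ) (w : ℂ) : ℝ :=
  firstForm X w 1 1 * firstForm X w Complex.I Complex.I - firstForm X w 1 Complex.I ^ 2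

/-- Orthogonal projection of the vector `V` at `X w` onto the tangent plane, spanned by
`X_u = dX 1` and `X_v = dX i`. -/
def tangentPart (X : ℂ → ℂ × ℝ) (w : ℂ) (V : ℂ × ℝ) : ℂ × ℝ :=
  let Xu := fderiv ℝ X w 1
  let Xv := fderiv ℝ X w Complex.I
  ((firstForm X w Complex.I Complex.I * metric (X w) V Xu
      - firstForm X w 1 Complex.I * metric (X w) V Xv) / firstFormDet X w) • Xu
  + ((firstForm X w 1 1 * metric (X w) V Xv
      - firstForm X w 1 Complex.I * metric (X w) V Xu) / firstFormDet X w) • Xv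

/-- Vector-valued second fundamental form: normal component of `∇_a (dX b)`. -/
def secondForm (X : ℂ → ℂ × ℝ) (w a b : ℂ) : ℂ × ℝ :=
  covDeriv X w a b - tangentPart X w (covDeriv X w a b)

/-- Mean curvature vector: half the trace of the second fundamental form with respect to the
first. -/
def meanCurvatureVector (X : ℂ → ℂ × ℝ) (w : ℂ) : ℂ × ℝ :=
  (1 / (2 * firstFormDet X w)) •
    (firstForm X w Complex.I Complex.I • secondForm X w 1 1
      - (2 * firstForm X w 1 Complex.I) • secondForm X w 1 Complex.I
      + firstForm X w 1 1 • secondForm X w Complex.I Complex.I)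

/-- `X` is minimal on `Ω`: its mean curvature vector vanishes. -/
def IsMinimal (X : ℂ → ℂ × ℝ) (Ω : Set ℂ) : Prop :=
  ∀ w ∈ Ω, meanCurvatureVector X w = 0

/-- Conformal factor `l` of the induced metric `l² |dw|²` of a conformal immersion. -/
def inducedFactor (X : ℂ → ℂ × ℝ) (w : ℂ) : ℝ := Real.sqrt (firstForm X w 1 1)

/-- Gauss curvature `-Δ(log l) / l²` of a conformal metric `l² |dw|²` on a planar domain, with
`Δ` the Euclidean Laplacian. -/
def conformalCurvature (l : ℂ → ℝ) (w : ℂ) : ℝ :=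
  -Laplacian.laplacian (fun z => Real.log (l z)) w / l w ^ 2

/-- Intrinsic (Gauss) curvature `K` of a conformal immersion. -/
def gaussCurvature (X : ℂ → ℂ × ℝ) (w : ℂ) : ℝ := conformalCurvature (inducedFactor X) w

/-- The tangent plane of `X` at `X w` is vertical: it contains `∂_t`. -/
def TangentVertical (X : ℂ → ℂ × ℝ) (w : ℂ) : Prop :=
  ((0, 1) : ℂ × ℝ) ∈ Set.range (fderiv ℝ X w)

/-- `Γ` is a (complete) geodesic of `ℍ²`: the trace of a curve defined on all of `ℝ`, with unit
hyperbolic speed and vanishing covariant acceleration. -/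
def IsGeodesic (Γ : Set ℂ) : Prop :=
  ∃ γ : ℝ → ℂ, ContDiff ℝ ∞ γ ∧ (∀ s, γ s ∈ disc) ∧
    (∀ s, sigma (γ s) * ‖deriv γ s‖ = 1) ∧
    (∀ s, deriv (deriv γ) s + christoffelDisc (γ s) (deriv γ s) (deriv γ s) = 0) ∧
    Γ = Set.range γ

end H2R

end

noncomputable section

open scoped ContDiff ComplexConjugate

namespace H2R

/-! ### Directional derivatives of smooth maps on a planar domain. -/

section Calculus

variable {E : Type*} [NormedAddCommGroup E] [NormedSpace ℝ E] {Ω : Set ℂ} {w : ℂ}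

/-! For a conformal immersion, minimality means that h and f are harmonic. So p = h_w and the
conjugate of q = h_{\bar w} are holomorphic for the pulled-back connection, and g = f_w is
holomorphic (`isHarmonicData`). The induced conformal factor is S = λ² = σ²|p|² + σ²|q|² + 2|g|²,
the squared length of Ψ = (p, \bar q, √2 g), with J the Jacobian of h and J = |p|² - |q|². The
curvature -1 of the target enters through the Ricci identity, which gives the covariant Laplacians
σ²J p and -σ²J q (`covD_laplacian`). Hence S ΔS - |∇S|² is 2Sσ⁴J² plus the Lagrange (Cauchy-Schwarz)
defect of Ψ and its derivative, a sum of squares (`IsHarmonicData.bochner`). Since Δ log λ = (S ΔS -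
|∇S|²)/(2S²), this is the Gauss equation, with K ≤ 0. At a zero of K every square vanishes. In
particular J = 0, so dh has a kernel vector, which dX sends to a nonzero vertical vector. This is
the first claim. If K vanishes identically, J = 0 and conformality give |g| = σ|p| ≠ 0, so N = p/g
is a unit field along h orthogonal to dh. The vanishing of the (p, g) square says that N is
parallel. In the hyperboloid model a parallel normal field is a constant spacelike unit vector of
Minkowski space, and h stays in its orthogonal plane, which cuts out a geodesic
(`IsHarmonicData.exists_isGeodesic`). -/

/-- Derivative of `F` in the constant direction `v`. -/
def pd (v : ℂ) (F : ℂ → E) (w : ℂ) : E := fderiv ℝ F w v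

theorem contDiffOn_pd (hΩ : IsOpen Ω) {F : ℂ → E} (hF : ContDiffOn ℝ ∞ F Ω) (v : ℂ) :
    ContDiffOn ℝ ∞ (pd v F) Ω :=
  (hF.fderiv_of_isOpen hΩ (m := ∞) (by simp)).clm_apply contDiffOn_const

theorem differentiableAt_of_contDiffOn (hΩ : IsOpen Ω) (hw : w ∈ Ω) {F : ℂ → E}
    (hF : ContDiffOn ℝ ∞ F Ω) : DifferentiableAt ℝ F w :=
  (hF.contDiffAt (hΩ.mem_nhds hw)).differentiableAt (by simp)

theorem fderiv_fderiv_apply (hΩ : IsOpen Ω) (hw : w ∈ Ω) {F : ℂ → E}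
    (hF : ContDiffOn ℝ ∞ F Ω) (a b : ℂ) :
    fderiv ℝ (fderiv ℝ F) w a b = pd a (pd b F) w := by
  have h : DifferentiableAt ℝ (fderiv ℝ F) w :=
    differentiableAt_of_contDiffOn hΩ hw (hF.fderiv_of_isOpen hΩ (m := ∞) (by simp))
  have := (h.hasFDerivAt.clm_apply (hasFDerivAt_const b w)).fderiv
  change _ = fderiv ℝ (fun y => fderiv ℝ F y b) w a
  rw [this]
  simp

theorem pd_comm (hΩ : IsOpen Ω) (hw : w ∈ Ω) {F : ℂ → E}
    (hF : ContDiffOn ℝ ∞ F Ω) (a b : ℂ) : pd a (pd b F) w = pd b (pd a F) w := by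
  rw [← fderiv_fderiv_apply hΩ hw hF, ← fderiv_fderiv_apply hΩ hw hF]
  exact ((hF.contDiffAt (hΩ.mem_nhds hw)).isSymmSndFDerivAt
    (by simpa using WithTop.coe_le_coe.2 (le_top : (2 : ℕ∞) ≤ ⊤))) a b

theorem hasDerivAt_line {F : ℂ → E} (hF : DifferentiableAt ℝ F w) (v : ℂ) :
    HasDerivAt (fun t : ℝ => F (w + t • v)) (pd v F w) 0 :=
  hF.hasFDerivAt.hasLineDerivAt v

theorem pd_eq_of_hasDerivAt {F : ℂ → E} (hF : DifferentiableAt ℝ F w) {v : ℂ} {F' : E}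
    (h : HasDerivAt (fun t : ℝ => F (w + t • v)) F' 0) : pd v F w = F' :=
  (hasDerivAt_line hF v).unique h

theorem pd_congr (hΩ : IsOpen Ω) (hw : w ∈ Ω) {F G : ℂ → E} (h : Set.EqOn F G Ω) (v : ℂ) :
    pd v F w = pd v G w := by
  have : F =ᶠ[nhds w] G := Filter.eventuallyEq_of_mem (hΩ.mem_nhds hw) h
  rw [pd, pd, this.fderiv_eq]

theorem laplacian_eq_pd (hΩ : IsOpen Ω) (hw : w ∈ Ω) {F : ℂ → E} (hF : ContDiffOn ℝ ∞ F Ω) :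
    Laplacian.laplacian F w = pd 1 (pd 1 F) w + pd Complex.I (pd Complex.I F) w := by
  rw [InnerProductSpace.laplacian_eq_iteratedFDeriv_complexPlane]
  simp only [iteratedFDeriv_two_apply, Matrix.cons_val_zero, Matrix.cons_val_one,
    fderiv_fderiv_apply hΩ hw hF]

theorem eq_of_pd_eq_zero (hΩ : IsOpen Ω) (hΩc : IsConnected Ω) {F : ℂ → E}
    (hF : DifferentiableOn ℝ F Ω) (h1 : ∀ w ∈ Ω, pd 1 F w = 0)
    (hI : ∀ w ∈ Ω, pd Complex.I F w = 0) : ∃ c, ∀ w ∈ Ω, F w = c := by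
  refine hΩ.exists_is_const_of_fderiv_eq_zero hΩc.isPreconnected hF fun w hw => ?_
  ext v
  have : v = v.re • (1 : ℂ) + v.im • Complex.I := by
    simp
  rw [this, map_add, map_smul, map_smul]
  have e1 := h1 w hw
  have eI := hI w hw
  simp only [pd] at e1 eI
  simp [e1, eI]

end Calculus

/-! ### The hyperbolic metric and its connection along a curve. -/

/-- The coefficient `2 (log σ)_z` of the Levi-Civita connection of the disc. -/
def conn (z : ℂ) : ℂ := 2 * conj z / (1 - (‖z‖ : ℂ) ^ 2)

section Curves

variable {z a b : ℝ → ℂ} {z' a' b' : ℂ}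

theorem one_sub_norm_sq_pos {z : ℂ} (hz : z ∈ disc) : 0 < 1 - ‖z‖ ^ 2 := by
  have h1 : ‖z‖ < 1 := by simpa [disc] using hz
  nlinarith [norm_nonneg z]

theorem sigma_pos {z : ℂ} (hz : z ∈ disc) : 0 < sigma z :=
  div_pos two_pos (one_sub_norm_sq_pos hz)

theorem hasDerivAt_re {t : ℝ} (ha : HasDerivAt a a' t) :
    HasDerivAt (fun t => (a t).re) a'.re t :=
  Complex.reCLM.hasFDerivAt.comp_hasDerivAt t ha

theorem hasDerivAt_conj {t : ℝ} (ha : HasDerivAt a a' t) :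
    HasDerivAt (fun t => conj (a t)) (conj a') t :=
  ha.star

theorem hasDerivAt_one_sub_norm_sq {t : ℝ} (hz : HasDerivAt z z' t) :
    HasDerivAt (fun t => 1 - ‖z t‖ ^ 2) (-2 * (z' * conj (z t)).re) t := by
  have h := ((hasDerivAt_re (hz.mul (hasDerivAt_conj hz))).const_sub 1)
  have e : (fun t => 1 - ‖z t‖ ^ 2) = fun t => 1 - ((z * fun t => conj (z t)) t).re := by
    funext s
    simp [Pi.mul_apply, Complex.mul_conj, Complex.sq_norm]
  rw [e]
  refine h.congr_deriv ?_
  simp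
  ring

/-- Compatibility of the covariant derivative along a curve with the hyperbolic metric. -/
theorem hasDerivAt_sigma_sq_mul_re {t : ℝ} (hz : HasDerivAt z z' t) (ha : HasDerivAt a a' t)
    (hb : HasDerivAt b b' t) (hd : z t ∈ disc) :
    HasDerivAt (fun t => sigma (z t) ^ 2 * (a t * conj (b t)).re)
      (sigma (z t) ^ 2 * (((a' + conn (z t) * z' * a t) * conj (b t)).re
        + (a t * conj (b' + conn (z t) * z' * b t)).re)) t := by
  have hp := (one_sub_norm_sq_pos hd).ne'
  have h := ((((hasDerivAt_const t (2 : ℝ)).div (hasDerivAt_one_sub_norm_sq hz) hp).pow 2).mul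
    (hasDerivAt_re (ha.mul (hasDerivAt_conj hb))))
  refine h.congr_deriv ?_
  have e : conn (z t) = ((2 / (1 - ‖z t‖ ^ 2) : ℝ) : ℂ) * conj (z t) := by
    simp only [conn]
    push_cast
    ring
  rw [e]
  simp only [sigma, Pi.mul_apply, Pi.pow_apply, Pi.div_apply]
  generalize 1 - ‖z t‖ ^ 2 = D at *
  simp
  field_simp
  ring

/-- Derivative of the connection coefficient along a curve. -/
theorem hasDerivAt_conn {t : ℝ} (hz : HasDerivAt z z' t) (hd : z t ∈ disc) :
    HasDerivAt (fun t => conn (z t))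
      (conn (z t) ^ 2 / 2 * z' + ((sigma (z t) ^ 2 / 2 : ℝ) : ℂ) * conj z') t := by
  have hp := (one_sub_norm_sq_pos hd).ne'
  have h := ((hasDerivAt_conj hz).const_mul 2).div
    (hasDerivAt_one_sub_norm_sq hz).ofReal_comp (by exact_mod_cast hp)
  have e : (fun t => conn (z t)) = fun t => 2 * conj (z t) / ((1 - ‖z t‖ ^ 2 : ℝ) : ℂ) := by
    funext s
    simp [conn]
  rw [e]
  refine h.congr_deriv ?_
  simp only [conn, sigma]
  have hz2 : ((1 - ‖z t‖ ^ 2 : ℝ) : ℂ) = 1 - z t * conj (z t) := by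
    rw [Complex.mul_conj, Complex.normSq_eq_norm_sq]
    push_cast
    ring
  have hre : ((-2 * (z' * conj (z t)).re : ℝ) : ℂ) = -(z' * conj (z t) + conj z' * z t) := by
    have := Complex.re_eq_add_conj (z' * conj (z t))
    push_cast
    rw [this]
    simp
    ring
  have hpc : (1 - z t * conj (z t)) ≠ 0 := by
    rw [← hz2]
    exact_mod_cast hp
  have hn : 1 - (‖z t‖ : ℂ) ^ 2 = 1 - z t * conj (z t) := by
    rw [← hz2]
    push_cast
    rfl
  rw [hre, Complex.ofReal_div, Complex.ofReal_pow, Complex.ofReal_div, hz2, hn]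
  push_cast
  field_simp
  ring

end Curves

/-! ### Covariant derivatives of fields along a map into the disc. -/

section Along

variable {Ω : Set ℂ} {w : ℂ} {h a b : ℂ → ℂ}

/-- Covariant derivative in the direction `v` of the field `a` of tangent vectors along the map
`h` into the disc. -/
def covD (h : ℂ → ℂ) (v : ℂ) (a : ℂ → ℂ) (w : ℂ) : ℂ := pd v a w + conn (h w) * pd v h w * a w

/-- Hyperbolic inner product of the fields `a` and `b` along `h`. -/
def hypInner (h a b : ℂ → ℂ) (w : ℂ) : ℝ := sigma (h w) ^ 2 * (a w * conj (b w)).re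

theorem contDiffOn_conj (ha : ContDiffOn ℝ ∞ a Ω) :
    ContDiffOn ℝ ∞ (fun w => conj (a w)) Ω :=
  Complex.conjCLE.contDiff.comp_contDiffOn ha

theorem contDiffOn_re (ha : ContDiffOn ℝ ∞ a Ω) : ContDiffOn ℝ ∞ (fun w => (a w).re) Ω :=
  Complex.reCLM.contDiff.comp_contDiffOn ha

theorem contDiffOn_ofReal {f : ℂ → ℝ} (hf : ContDiffOn ℝ ∞ f Ω) :
    ContDiffOn ℝ ∞ (fun w => (f w : ℂ)) Ω :=
  Complex.ofRealCLM.contDiff.comp_contDiffOn hf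

theorem contDiffOn_one_sub_norm_sq (hh : ContDiffOn ℝ ∞ h Ω) :
    ContDiffOn ℝ ∞ (fun w => 1 - ‖h w‖ ^ 2) Ω :=
  contDiffOn_const.sub (hh.norm_sq ℝ)

theorem contDiffOn_sigma (hh : ContDiffOn ℝ ∞ h Ω) (hd : ∀ w ∈ Ω, h w ∈ disc) :
    ContDiffOn ℝ ∞ (fun w => sigma (h w)) Ω :=
  contDiffOn_const.div (contDiffOn_one_sub_norm_sq hh) fun w hw =>
    (one_sub_norm_sq_pos (hd w hw)).ne'

theorem contDiffOn_conn (hh : ContDiffOn ℝ ∞ h Ω) (hd : ∀ w ∈ Ω, h w ∈ disc) :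
    ContDiffOn ℝ ∞ (fun w => conn (h w)) Ω := by
  have e : (fun w => conn (h w)) = fun w => (sigma (h w) : ℂ) * conj (h w) := by
    funext w
    simp only [conn, sigma]
    push_cast
    ring
  rw [e]
  exact (contDiffOn_ofReal (contDiffOn_sigma hh hd)).mul (contDiffOn_conj hh)

theorem contDiffOn_covD (hΩ : IsOpen Ω) (hh : ContDiffOn ℝ ∞ h Ω) (hd : ∀ w ∈ Ω, h w ∈ disc)
    (ha : ContDiffOn ℝ ∞ a Ω) (v : ℂ) : ContDiffOn ℝ ∞ (covD h v a) Ω :=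
  (contDiffOn_pd hΩ ha v).add (((contDiffOn_conn hh hd).mul (contDiffOn_pd hΩ hh v)).mul ha)

theorem contDiffOn_hypInner (hh : ContDiffOn ℝ ∞ h Ω) (hd : ∀ w ∈ Ω, h w ∈ disc)
    (ha : ContDiffOn ℝ ∞ a Ω) (hb : ContDiffOn ℝ ∞ b Ω) : ContDiffOn ℝ ∞ (hypInner h a b) Ω :=
  ((contDiffOn_sigma hh hd).pow 2).mul (contDiffOn_re (ha.mul (contDiffOn_conj hb)))

theorem pd_hypInner (hΩ : IsOpen Ω) (hw : w ∈ Ω) (hh : ContDiffOn ℝ ∞ h Ω)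
    (hd : ∀ w ∈ Ω, h w ∈ disc) (ha : ContDiffOn ℝ ∞ a Ω) (hb : ContDiffOn ℝ ∞ b Ω) (v : ℂ) :
    pd v (hypInner h a b) w = hypInner h (covD h v a) b w + hypInner h a (covD h v b) w := by
  have D := @differentiableAt_of_contDiffOn ℂ _ _ Ω w hΩ hw
  have e := hasDerivAt_sigma_sq_mul_re (hasDerivAt_line (D hh) v) (hasDerivAt_line (D ha) v)
    (hasDerivAt_line (D hb) v) (by simpa using hd w hw)
  rw [pd_eq_of_hasDerivAt (differentiableAt_of_contDiffOn hΩ hw (contDiffOn_hypInner hh hd ha hb)) e]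
  simp only [zero_smul, add_zero, hypInner, covD]
  ring

theorem hypInner_comm (h a b : ℂ → ℂ) (w : ℂ) : hypInner h a b w = hypInner h b a w := by
  simp only [hypInner, Complex.mul_re, Complex.conj_re, Complex.conj_im]
  ring

/-- The covariant derivative along a map is torsion free. -/
theorem covD_pd_comm (hΩ : IsOpen Ω) (hw : w ∈ Ω) (hh : ContDiffOn ℝ ∞ h Ω) (u v : ℂ) :
    covD h u (pd v h) w = covD h v (pd u h) w := by
  rw [covD, covD, pd_comm hΩ hw hh]
  ring

end Along

/-! ### Conformal minimal immersions are harmonic. -/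

section Minimal

variable {Ω : Set ℂ} {X : ℂ → ℂ × ℝ} {w : ℂ}

theorem fderiv_apply_eq (hΩ : IsOpen Ω) (hX : ContDiffOn ℝ ∞ X Ω) (hw : w ∈ Ω) (v : ℂ) :
    fderiv ℝ X w v = (pd v (fun w => (X w).1) w, pd v (fun w => (X w).2) w) := by
  have hd := (differentiableAt_of_contDiffOn hΩ hw hX).hasFDerivAt
  rw [pd, pd, hd.fst.fderiv, hd.snd.fderiv]
  rfl

/-- The connection of the product splits, and its ℝ factor is flat. -/
theorem covDeriv_eq (hΩ : IsOpen Ω) (hX : ContDiffOn ℝ ∞ X Ω) (hw : w ∈ Ω) (u v : ℂ) :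
    covDeriv X w u v = (covD (fun w => (X w).1) u (pd v fun w => (X w).1) w,
      pd u (pd v fun w => (X w).2) w) := by
  have h2 := fderiv_apply_eq hΩ (contDiffOn_pd hΩ hX v) hw u
  have h1 : Set.EqOn (fun w => (pd v X w).1) (pd v fun w => (X w).1) Ω := fun w hw => by
    exact congrArg Prod.fst (fderiv_apply_eq hΩ hX hw v)
  have h3 : Set.EqOn (fun w => (pd v X w).2) (pd v fun w => (X w).2) Ω := fun w hw => by
    exact congrArg Prod.snd (fderiv_apply_eq hΩ hX hw v)
  rw [covDeriv, fderiv_fderiv_apply hΩ hw hX, pd, h2, fderiv_apply_eq hΩ hX hw,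
    fderiv_apply_eq hΩ hX hw, pd_congr hΩ hw h1, pd_congr hΩ hw h3]
  ext
  · simp [christoffel, christoffelDisc, covD, conn]
  · simp [christoffel]

theorem firstForm_eq (hΩ : IsOpen Ω) (hX : ContDiffOn ℝ ∞ X Ω) (hw : w ∈ Ω) (u v : ℂ) :
    firstForm X w u v = hypInner (fun w => (X w).1) (pd u fun w => (X w).1)
      (pd v fun w => (X w).1) w + pd u (fun w => (X w).2) w * pd v (fun w => (X w).2) w := by
  rw [firstForm, fderiv_apply_eq hΩ hX hw, fderiv_apply_eq hΩ hX hw]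
  rfl

theorem metric_add_left (p a b c : ℂ × ℝ) :
    metric p (a + b) c = metric p a c + metric p b c := by
  simp [metric]
  ring

theorem metric_comm (p a b : ℂ × ℝ) : metric p a b = metric p b a := by
  simp [metric]
  ring

theorem metric_self_pos {p a : ℂ × ℝ} (hp : p.1 ∈ disc) (ha : a ≠ 0) : 0 < metric p a a := by
  have hs := sigma_pos hp
  have e : metric p a a = sigma p.1 ^ 2 * ‖a.1‖ ^ 2 + a.2 ^ 2 := by
    simp [metric, Complex.mul_conj, Complex.normSq_eq_norm_sq, sq]
  rw [e]
  by_cases h1 : a.1 = 0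
  · have h2 : a.2 ≠ 0 := fun h2 => ha (Prod.ext h1 h2)
    positivity
  · have : 0 < ‖a.1‖ := norm_pos_iff.2 h1
    positivity

theorem fderiv_ne_zero (hX : IsConformalImmersion X Ω) (hw : w ∈ Ω) {v : ℂ} (hv : v ≠ 0) :
    fderiv ℝ X w v ≠ 0 := fun h => hv (hX.immersion w hw (by rw [h, map_zero]))

theorem firstForm_pos (hX : IsConformalImmersion X Ω) (hw : w ∈ Ω) : 0 < firstForm X w 1 1 :=
  metric_self_pos (hX.mapsTo w hw) (fderiv_ne_zero hX hw one_ne_zero)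

theorem pd_firstForm (hΩ : IsOpen Ω) (hX : IsConformalImmersion X Ω) (hw : w ∈ Ω) (u a b : ℂ) :
    pd u (fun w => firstForm X w a b) w = metric (X w) (covDeriv X w u a) (fderiv ℝ X w b)
      + metric (X w) (fderiv ℝ X w a) (covDeriv X w u b) := by
  have hs := hX.smooth
  have hh : ContDiffOn ℝ ∞ (fun w => (X w).1) Ω := hs.fst
  have hf : ContDiffOn ℝ ∞ (fun w => (X w).2) Ω := hs.snd
  rw [pd_congr hΩ hw (fun w hw => firstForm_eq hΩ hs hw a b), covDeriv_eq hΩ hs hw,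
    covDeriv_eq hΩ hs hw, fderiv_apply_eq hΩ hs hw, fderiv_apply_eq hΩ hs hw]
  have d1 := differentiableAt_of_contDiffOn hΩ hw (contDiffOn_hypInner hh hX.mapsTo
    (contDiffOn_pd hΩ hh a) (contDiffOn_pd hΩ hh b))
  have d2 := differentiableAt_of_contDiffOn hΩ hw (contDiffOn_pd hΩ hf a)
  have d3 := differentiableAt_of_contDiffOn hΩ hw (contDiffOn_pd hΩ hf b)
  have e := (hasDerivAt_line d1 u).add ((hasDerivAt_line d2 u).mul (hasDerivAt_line d3 u))
  refine (pd_eq_of_hasDerivAt (d1.add (d2.mul d3)) e).trans ?_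
  rw [pd_hypInner hΩ hw hh hX.mapsTo (contDiffOn_pd hΩ hh a) (contDiffOn_pd hΩ hh b)]
  simp only [zero_smul, add_zero, hypInner, metric]
  ring

/-- The components of a conformal minimal immersion are harmonic. -/
theorem covDeriv_add_eq_zero (hΩ : IsOpen Ω) (hX : IsConformalImmersion X Ω)
    (hmin : IsMinimal X Ω) (hw : w ∈ Ω) :
    covDeriv X w 1 1 + covDeriv X w Complex.I Complex.I = 0 := by
  have hE := firstForm_pos hX hw
  have hG := hX.equal_length w hw
  have hF := hX.orthogonal w hw
  have hsymm : covDeriv X w 1 Complex.I = covDeriv X w Complex.I 1 := by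
    rw [covDeriv_eq hΩ hX.smooth hw, covDeriv_eq hΩ hX.smooth hw,
      covD_pd_comm hΩ hw hX.smooth.fst, pd_comm hΩ hw hX.smooth.snd]
  -- Differentiating E = G and F = 0 in both directions, and using the torsion-free symmetry, shows
  -- that V = ∇_u X_u + ∇_v X_v is orthogonal to X_u and X_v. So V is its own normal part, and the
  -- mean curvature vector is V/(2E).
  have g1 := pd_congr hΩ hw hX.equal_length 1
  have gI := pd_congr hΩ hw hX.equal_length Complex.I
  have o1 := pd_congr hΩ hw hX.orthogonal 1
  have oI := pd_congr hΩ hw hX.orthogonal Complex.I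
  have z : ∀ v, pd v (fun _ : ℂ => (0 : ℝ)) w = 0 := fun v => by simp [pd]
  rw [z] at o1 oI
  rw [pd_firstForm hΩ hX hw] at o1 oI
  rw [pd_firstForm hΩ hX hw, pd_firstForm hΩ hX hw] at g1 gI
  have hVu : metric (X w) (covDeriv X w 1 1 + covDeriv X w Complex.I Complex.I)
      (fderiv ℝ X w 1) = 0 := by
    rw [metric_add_left]
    rw [metric_comm _ (fderiv ℝ X w 1)] at oI g1
    rw [metric_comm _ (fderiv ℝ X w Complex.I)] at g1
    rw [hsymm] at g1
    linarith
  have hVv : metric (X w) (covDeriv X w 1 1 + covDeriv X w Complex.I Complex.I)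
      (fderiv ℝ X w Complex.I) = 0 := by
    rw [metric_add_left]
    rw [metric_comm _ (fderiv ℝ X w 1)] at o1 gI
    rw [metric_comm _ (fderiv ℝ X w Complex.I)] at gI
    rw [hsymm] at o1
    linarith
  have hm := hmin w hw
  set V := covDeriv X w 1 1 + covDeriv X w Complex.I Complex.I with hV
  have hsum : secondForm X w 1 1 + secondForm X w Complex.I Complex.I
      = V - tangentPart X w V := by
    have ht : tangentPart X w (covDeriv X w 1 1) + tangentPart X w (covDeriv X w Complex.I Complex.I)
        = tangentPart X w V := by
      simp only [tangentPart, hV, metric_add_left]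
      module
    rw [← ht, secondForm, secondForm, hV]
    abel
  have htan : tangentPart X w V = 0 := by
    simp [tangentPart, hVu, hVv]
  rw [htan, sub_zero] at hsum
  rw [meanCurvatureVector, hF, ← hG, mul_zero, zero_smul, sub_zero, ← smul_add, hsum, smul_smul,
    firstFormDet, hF, ← hG] at hm
  refine (smul_eq_zero.1 hm).resolve_left ?_
  have : firstForm X w 1 1 ≠ 0 := hE.ne'
  have h2 : 2 * (firstForm X w 1 1 * firstForm X w 1 1 - 0 ^ 2) ≠ 0 := by
    simpa using this
  exact mul_ne_zero (one_div_ne_zero h2) this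

end Minimal

/-! ### The Ricci identity and covariant Laplacians. -/

section Curvature

variable {Ω : Set ℂ} {w : ℂ} {h a b : ℂ → ℂ}

/-- Jacobian determinant of a map of planar domains. -/
def jac (h : ℂ → ℂ) (w : ℂ) : ℝ := (conj (pd 1 h w) * pd Complex.I h w).im

theorem covD_congr (hΩ : IsOpen Ω) (hw : w ∈ Ω) (hab : Set.EqOn a b Ω) (v : ℂ) :
    covD h v a w = covD h v b w := by
  rw [covD, covD, pd_congr hΩ hw hab, hab hw]

theorem pd_const_mul (hΩ : IsOpen Ω) (hw : w ∈ Ω) (ha : ContDiffOn ℝ ∞ a Ω) (c v : ℂ) :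
    pd v (fun w => c * a w) w = c * pd v a w := by
  have D := differentiableAt_of_contDiffOn hΩ hw ha
  exact pd_eq_of_hasDerivAt (D.const_mul c) ((hasDerivAt_line D v).const_mul c)

theorem covD_const_mul (hΩ : IsOpen Ω) (hw : w ∈ Ω) (ha : ContDiffOn ℝ ∞ a Ω) (c v : ℂ) :
    covD h v (fun w => c * a w) w = c * covD h v a w := by
  rw [covD, covD, pd_const_mul hΩ hw ha]
  ring

theorem pd_covD (hΩ : IsOpen Ω) (hw : w ∈ Ω) (hh : ContDiffOn ℝ ∞ h Ω)
    (hd : ∀ w ∈ Ω, h w ∈ disc) (ha : ContDiffOn ℝ ∞ a Ω) (u v : ℂ) :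
    pd u (covD h v a) w = pd u (pd v a) w
      + ((conn (h w) ^ 2 / 2 * pd u h w + ((sigma (h w) ^ 2 / 2 : ℝ) : ℂ) * conj (pd u h w))
          * pd v h w + conn (h w) * pd u (pd v h) w) * a w
      + conn (h w) * pd v h w * pd u a w := by
  have D := @differentiableAt_of_contDiffOn ℂ _ _ Ω w hΩ hw
  have e := (hasDerivAt_line (D (contDiffOn_pd hΩ ha v)) u).add
    (((hasDerivAt_conn (hasDerivAt_line (D hh) u) (by simpa using hd w hw)).mul
      (hasDerivAt_line (D (contDiffOn_pd hΩ hh v)) u)).mul (hasDerivAt_line (D ha) u))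
  refine (pd_eq_of_hasDerivAt (D (contDiffOn_covD hΩ hh hd ha v)) e).trans ?_
  simp only [zero_smul, add_zero, Pi.mul_apply]
  ring

/-- The Ricci identity along a map into the hyperbolic plane. -/
theorem covD_covD_comm (hΩ : IsOpen Ω) (hw : w ∈ Ω) (hh : ContDiffOn ℝ ∞ h Ω)
    (hd : ∀ w ∈ Ω, h w ∈ disc) (ha : ContDiffOn ℝ ∞ a Ω) :
    covD h 1 (covD h Complex.I a) w - covD h Complex.I (covD h 1 a) w
      = Complex.I * (sigma (h w) ^ 2 * jac h w : ℝ) * a w := by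
  have hj : (jac h w : ℂ) * (2 * Complex.I)
      = conj (pd 1 h w) * pd Complex.I h w - conj (pd Complex.I h w) * pd 1 h w := by
    have := Complex.im_eq_sub_conj (conj (pd 1 h w) * pd Complex.I h w)
    rw [jac, this, div_mul_cancel₀ _ (by simp)]
    simp
    ring
  have e : ∀ u v, covD h u (covD h v a) w
      = pd u (covD h v a) w + conn (h w) * pd u h w * covD h v a w := fun _ _ => rfl
  rw [e, e, pd_covD hΩ hw hh hd ha, pd_covD hΩ hw hh hd ha, pd_comm hΩ hw ha 1,
    pd_comm hΩ hw hh 1, covD, covD]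
  push_cast
  -- Everything symmetric in the two directions cancels; what survives is the σ²/2 term of the
  -- derivative of `conn`, which carries the curvature.
  linear_combination (-(sigma (h w) : ℂ) ^ 2 / 2 * a w) * hj

/-- Bochner formula for a field whose covariant derivative is complex linear (`ε = i`) or
antilinear (`ε = -i`). -/
theorem covD_laplacian (hΩ : IsOpen Ω) (hh : ContDiffOn ℝ ∞ h Ω)
    (hd : ∀ w ∈ Ω, h w ∈ disc) (ha : ContDiffOn ℝ ∞ a Ω) {ε : ℂ} (hε : ε ^ 2 = -1)
    (hc : ∀ w ∈ Ω, covD h Complex.I a w = ε * covD h 1 a w) (hw : w ∈ Ω) :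
    covD h 1 (covD h 1 a) w + covD h Complex.I (covD h Complex.I a) w
      = -(ε * Complex.I) * (sigma (h w) ^ 2 * jac h w : ℝ) * a w := by
  have h1 := covD_covD_comm hΩ hw hh hd ha
  have hs := contDiffOn_covD hΩ hh hd ha 1
  have h2 := fun v => (covD_congr (h := h) hΩ hw hc v).trans (covD_const_mul hΩ hw hs ε v)
  rw [h2] at h1
  rw [h2]
  -- Since ∇_I a = ε ∇_1 a and ε² = -1, the Laplacian is -ε times the commutator of ∇_1 and ∇_I.
  linear_combination (-ε) * h1 + covD h 1 (covD h 1 a) w * hε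

end Curvature

/-! ### The Laplacian of the logarithm of a conformal factor. -/

section LogLaplacian

variable {Ω : Set ℂ} {w : ℂ} {S : ℂ → ℝ}

theorem laplacian_log_sqrt (hΩ : IsOpen Ω) (hS : ContDiffOn ℝ ∞ S Ω) (hpos : ∀ w ∈ Ω, 0 < S w)
    (hw : w ∈ Ω) :
    Laplacian.laplacian (fun w => Real.log (Real.sqrt (S w))) w
      = (S w * (pd 1 (pd 1 S) w + pd Complex.I (pd Complex.I S) w)
        - (pd 1 S w ^ 2 + pd Complex.I S w ^ 2)) / (2 * S w ^ 2) := by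
  have D := fun {F : ℂ → ℝ} {w : ℂ} hw hF => @differentiableAt_of_contDiffOn ℝ _ _ Ω w hΩ hw F hF
  have hlog : ContDiffOn ℝ ∞ (fun w => Real.log (Real.sqrt (S w))) Ω :=
    (hS.sqrt fun w hw => (hpos w hw).ne').log fun w hw => (Real.sqrt_pos.2 (hpos w hw)).ne'
  have h1 : ∀ v, Set.EqOn (pd v fun w => Real.log (Real.sqrt (S w)))
      (fun w => pd v S w / (2 * S w)) Ω := fun v w hw => by
    have hp := hpos w hw
    have e : Set.EqOn (fun w => Real.log (Real.sqrt (S w))) (fun w => Real.log (S w) / 2) Ω :=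
      fun w hw => Real.log_sqrt (hpos w hw).le
    have d := D hw hS
    rw [pd_congr hΩ hw e]
    have dl : DifferentiableAt ℝ (fun w => Real.log (S w) / 2) w := by
      fun_prop (disch := exact hp.ne')
    refine (pd_eq_of_hasDerivAt dl
      (((hasDerivAt_line d v).log (by simpa using hp.ne')).div_const 2)).trans ?_
    simp only [zero_smul, add_zero]
    field_simp
  have h2 : ∀ v, pd v (pd v fun w => Real.log (Real.sqrt (S w))) w
      = (S w * pd v (pd v S) w - pd v S w ^ 2) / (2 * S w ^ 2) := fun v => by
    have hp := hpos w hw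
    have d := D hw hS
    have d' := D hw (contDiffOn_pd hΩ hS v)
    have hne : 2 * S w ≠ 0 := by positivity
    rw [pd_congr hΩ hw (h1 v)]
    have dq : DifferentiableAt ℝ (fun w => pd v S w / (2 * S w)) w := by
      fun_prop (disch := exact hne)
    refine (pd_eq_of_hasDerivAt dq ((hasDerivAt_line d' v).div ((hasDerivAt_line d v).const_mul 2)
      (by simpa using hp.ne'))).trans ?_
    simp only [zero_smul, add_zero]
    field_simp
  rw [laplacian_eq_pd hΩ hw hlog, h2, h2]
  field_simp
  ring

end LogLaplacian

/-! ### Complex derivatives of a conformal harmonic immersion. -/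

section Data

variable {Ω : Set ℂ} {w : ℂ} {h p q g : ℂ → ℂ}

/-- The complex derivatives `p = h_w`, `q = h_{\bar w}`, `g = f_w` of the components of a
conformal harmonic immersion `(h, f)` into `ℍ² × ℝ`, with the equations that they satisfy. -/
structure IsHarmonicData (h p q g : ℂ → ℂ) (Ω : Set ℂ) : Prop where
  smooth : ContDiffOn ℝ ∞ h Ω
  smooth_p : ContDiffOn ℝ ∞ p Ω
  smooth_q : ContDiffOn ℝ ∞ q Ω
  smooth_g : ContDiffOn ℝ ∞ g Ω
  mapsTo : ∀ w ∈ Ω, h w ∈ disc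
  pd_one : ∀ w ∈ Ω, pd 1 h w = p w + q w
  pd_I : ∀ w ∈ Ω, pd Complex.I h w = Complex.I * (p w - q w)
  covD_p : ∀ w ∈ Ω, covD h Complex.I p w = Complex.I * covD h 1 p w
  covD_q : ∀ w ∈ Ω, covD h Complex.I q w = -Complex.I * covD h 1 q w
  pd_g : ∀ w ∈ Ω, pd Complex.I g w = Complex.I * pd 1 g w
  conformal : ∀ w ∈ Ω, g w ^ 2 = -((sigma (h w) : ℂ) ^ 2 * p w * conj (q w))

/-- Square of the conformal factor in terms of the complex derivatives. -/
def energy (h p q g : ℂ → ℂ) (w : ℂ) : ℝ :=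
  hypInner h p p w + hypInner h q q w + 2 * (g w * conj (g w)).re

variable (H : IsHarmonicData h p q g Ω)
include H

theorem IsHarmonicData.jac_eq (hw : w ∈ Ω) :
    jac h w = Complex.normSq (p w) - Complex.normSq (q w) := by
  rw [jac, H.pd_one w hw, H.pd_I w hw]
  simp [Complex.normSq_apply]
  ring

theorem IsHarmonicData.contDiffOn_energy : ContDiffOn ℝ ∞ (energy h p q g) Ω :=
  ((contDiffOn_hypInner H.smooth H.mapsTo H.smooth_p H.smooth_p).add
    (contDiffOn_hypInner H.smooth H.mapsTo H.smooth_q H.smooth_q)).add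
    (contDiffOn_const.mul (contDiffOn_re (H.smooth_g.mul (contDiffOn_conj H.smooth_g))))

end Data

theorem contDiffOn_mul_conj_re {Ω : Set ℂ} {a b : ℂ → ℂ} (ha : ContDiffOn ℝ ∞ a Ω)
    (hb : ContDiffOn ℝ ∞ b Ω) : ContDiffOn ℝ ∞ (fun w => (a w * conj (b w)).re) Ω :=
  contDiffOn_re (ha.mul (contDiffOn_conj hb))

theorem pd_mul_conj_re {Ω : Set ℂ} {w : ℂ} {a b : ℂ → ℂ} (hΩ : IsOpen Ω) (hw : w ∈ Ω)
    (ha : ContDiffOn ℝ ∞ a Ω) (hb : ContDiffOn ℝ ∞ b Ω) (v : ℂ) :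
    pd v (fun w => (a w * conj (b w)).re) w
      = (pd v a w * conj (b w)).re + (a w * conj (pd v b w)).re := by
  have da := differentiableAt_of_contDiffOn hΩ hw ha
  have db := differentiableAt_of_contDiffOn hΩ hw hb
  have dd := differentiableAt_of_contDiffOn hΩ hw (contDiffOn_mul_conj_re ha hb)
  refine (pd_eq_of_hasDerivAt dd (hasDerivAt_re ((hasDerivAt_line da v).mul
    (hasDerivAt_conj (hasDerivAt_line db v))))).trans ?_
  simp

theorem pd_lincomb {Ω : Set ℂ} {w : ℂ} {F G K : ℂ → ℝ} (hΩ : IsOpen Ω) (hw : w ∈ Ω)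
    (hF : ContDiffOn ℝ ∞ F Ω) (hG : ContDiffOn ℝ ∞ G Ω) (hK : ContDiffOn ℝ ∞ K Ω)
    (c d : ℝ) (v : ℂ) :
    pd v (fun w => c * F w + c * G w + d * K w) w
      = c * pd v F w + c * pd v G w + d * pd v K w := by
  have dF := differentiableAt_of_contDiffOn hΩ hw hF
  have dG := differentiableAt_of_contDiffOn hΩ hw hG
  have dK := differentiableAt_of_contDiffOn hΩ hw hK
  exact pd_eq_of_hasDerivAt (((dF.const_mul c).add (dG.const_mul c)).add (dK.const_mul d))
    ((((hasDerivAt_line dF v).const_mul c).add ((hasDerivAt_line dG v).const_mul c)).add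
      ((hasDerivAt_line dK v).const_mul d))

/-! ### Bochner formula for the conformal factor. -/

section Bochner

variable {Ω : Set ℂ} {w : ℂ} {h p q g : ℂ → ℂ} (H : IsHarmonicData h p q g Ω)
include H

theorem IsHarmonicData.pd_energy (hΩ : IsOpen Ω) (hw : w ∈ Ω) (v : ℂ) :
    pd v (energy h p q g) w = 2 * hypInner h (covD h v p) p w + 2 * hypInner h (covD h v q) q w
      + 4 * (pd v g w * conj (g w)).re := by
  have e : energy h p q g = fun w => 1 * hypInner h p p w + 1 * hypInner h q q w
      + 2 * (g w * conj (g w)).re := by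
    funext w
    simp [energy]
  rw [e, pd_lincomb hΩ hw (contDiffOn_hypInner H.smooth H.mapsTo H.smooth_p H.smooth_p)
    (contDiffOn_hypInner H.smooth H.mapsTo H.smooth_q H.smooth_q)
    (contDiffOn_mul_conj_re H.smooth_g H.smooth_g),
    pd_hypInner hΩ hw H.smooth H.mapsTo H.smooth_p H.smooth_p,
    pd_hypInner hΩ hw H.smooth H.mapsTo H.smooth_q H.smooth_q,
    pd_mul_conj_re hΩ hw H.smooth_g H.smooth_g, hypInner_comm h p, hypInner_comm h q]
  simp only [Complex.mul_re, Complex.conj_re, Complex.conj_im]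
  ring

theorem IsHarmonicData.pd_pd_energy (hΩ : IsOpen Ω) (hw : w ∈ Ω) (v : ℂ) :
    pd v (pd v (energy h p q g)) w
      = 2 * (hypInner h (covD h v (covD h v p)) p w + hypInner h (covD h v p) (covD h v p) w)
      + 2 * (hypInner h (covD h v (covD h v q)) q w + hypInner h (covD h v q) (covD h v q) w)
      + 4 * ((pd v (pd v g) w * conj (g w)).re + (pd v g w * conj (pd v g w)).re) := by
  have sp := contDiffOn_covD hΩ H.smooth H.mapsTo H.smooth_p v
  have sq := contDiffOn_covD hΩ H.smooth H.mapsTo H.smooth_q v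
  have sg := contDiffOn_pd hΩ H.smooth_g v
  rw [pd_congr hΩ hw (fun w hw => H.pd_energy hΩ hw v),
    pd_lincomb hΩ hw (contDiffOn_hypInner H.smooth H.mapsTo sp H.smooth_p)
    (contDiffOn_hypInner H.smooth H.mapsTo sq H.smooth_q)
    (contDiffOn_mul_conj_re sg H.smooth_g),
    pd_hypInner hΩ hw H.smooth H.mapsTo sp H.smooth_p,
    pd_hypInner hΩ hw H.smooth H.mapsTo sq H.smooth_q,
    pd_mul_conj_re hΩ hw sg H.smooth_g]

/-- The covariant Laplacians of p and q contribute 2σ⁴J(|p|² - |q|²) = 2σ⁴J², and g is harmonic. The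
other terms are squared first derivatives, where the two directions contribute equally by
(anti)holomorphy. -/
theorem IsHarmonicData.laplacian_energy (hΩ : IsOpen Ω) (hw : w ∈ Ω) :
    pd 1 (pd 1 (energy h p q g)) w + pd Complex.I (pd Complex.I (energy h p q g)) w
      = 4 * sigma (h w) ^ 2 * Complex.normSq (covD h 1 p w)
        + 4 * sigma (h w) ^ 2 * Complex.normSq (covD h 1 q w) + 8 * Complex.normSq (pd 1 g w)
        + 2 * sigma (h w) ^ 4 * jac h w ^ 2 := by
  have hp := covD_laplacian hΩ H.smooth H.mapsTo H.smooth_p Complex.I_sq H.covD_p hw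
  have hq := covD_laplacian hΩ H.smooth H.mapsTo H.smooth_q (ε := -Complex.I) (by simp) H.covD_q hw
  have hg : pd 1 (pd 1 g) w + pd Complex.I (pd Complex.I g) w = 0 := by
    have e := fun v => (pd_congr hΩ hw H.pd_g v).trans
      (pd_const_mul hΩ hw (contDiffOn_pd hΩ H.smooth_g 1) Complex.I v)
    rw [e, pd_comm hΩ hw H.smooth_g Complex.I, e]
    linear_combination pd 1 (pd 1 g) w * Complex.I_sq
  rw [H.pd_pd_energy hΩ hw, H.pd_pd_energy hΩ hw]
  have hp' := congrArg (fun x => (x * conj (p w)).re) hp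
  have hq' := congrArg (fun x => (x * conj (q w)).re) hq
  have hg' := congrArg (fun x => (x * conj (g w)).re) hg
  have hj := H.jac_eq hw
  simp only [hypInner, H.covD_p w hw, H.covD_q w hw, H.pd_g w hw]
  generalize covD h 1 (covD h 1 p) w = A at *
  generalize covD h Complex.I (covD h Complex.I p) w = B at *
  generalize covD h 1 (covD h 1 q) w = C at *
  generalize covD h Complex.I (covD h Complex.I q) w = D at *
  generalize pd 1 (pd 1 g) w = F at *
  generalize pd Complex.I (pd Complex.I g) w = G at *
  simp only [Complex.normSq_apply, neg_mul, Complex.I_mul_I, neg_neg, one_mul, Complex.mul_re,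
    Complex.mul_im, Complex.add_re, Complex.add_im, Complex.conj_re, Complex.conj_im,
    Complex.neg_re, Complex.neg_im, Complex.I_re, Complex.I_im, Complex.ofReal_re,
    Complex.ofReal_im, Complex.zero_re, Complex.zero_im]
    at hp' hq' hg' hj ⊢
  linear_combination 2 * sigma (h w) ^ 2 * hp' + 2 * sigma (h w) ^ 2 * hq' + 4 * hg'
    - 2 * sigma (h w) ^ 4 * jac h w * hj

/-- Lagrange's identity for (σp, σ\bar q, √2 g) and its covariant derivative: the Cauchy-Schwarz
defect is a sum of three squared 2×2 minors. Only the (p, g) minor is kept. -/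
theorem IsHarmonicData.bochner (hΩ : IsOpen Ω) (hw : w ∈ Ω) :
    2 * energy h p q g w * sigma (h w) ^ 4 * jac h w ^ 2
      + 8 * sigma (h w) ^ 2 * Complex.normSq (covD h 1 p w * g w - p w * pd 1 g w)
    ≤ energy h p q g w *
        (pd 1 (pd 1 (energy h p q g)) w + pd Complex.I (pd Complex.I (energy h p q g)) w)
      - (pd 1 (energy h p q g) w ^ 2 + pd Complex.I (energy h p q g) w ^ 2) := by
  rw [H.laplacian_energy hΩ hw, H.pd_energy hΩ hw, H.pd_energy hΩ hw]
  simp only [hypInner, H.covD_p w hw, H.covD_q w hw, H.pd_g w hw, energy]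
  generalize covD h 1 p w = P
  generalize covD h 1 q w = Q
  generalize pd 1 g w = G
  generalize p w = a
  generalize q w = b
  generalize g w = c
  generalize sigma (h w) = s
  -- The discarded minors, for the pairs (p, \bar q) and (\bar q, g); they account for the whole
  -- difference of the two sides.
  have h1 : 0 ≤ 4 * s ^ 4 * Complex.normSq (P * conj b - conj Q * a) :=
    mul_nonneg (by positivity) (Complex.normSq_nonneg _)
  have h2 : 0 ≤ 8 * s ^ 2 * Complex.normSq (conj Q * c - conj b * G) :=
    mul_nonneg (by positivity) (Complex.normSq_nonneg _)
  rw [← sub_nonneg]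
  refine (add_nonneg h1 h2).trans_eq ?_
  simp only [Complex.normSq_apply, neg_mul, Complex.mul_re, Complex.sub_re, Complex.sub_im,
    Complex.mul_im, Complex.conj_re, Complex.conj_im, Complex.neg_re, Complex.I_re, Complex.I_im]
  ring

end Bochner

/-! ### Wirtinger derivatives. -/

section

variable {Ω : Set ℂ} {w : ℂ} {a b : ℂ → ℂ}

/-- The Wirtinger derivative `∂F/∂w`. -/
def dz (F : ℂ → ℂ) (w : ℂ) : ℂ := 1 / 2 * pd 1 F w + -Complex.I / 2 * pd Complex.I F w

/-- The Wirtinger derivative `∂F/∂\bar w`. -/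
def dzbar (F : ℂ → ℂ) (w : ℂ) : ℂ := 1 / 2 * pd 1 F w + Complex.I / 2 * pd Complex.I F w

theorem contDiffOn_const_mul_add (ha : ContDiffOn ℝ ∞ a Ω) (hb : ContDiffOn ℝ ∞ b Ω) (c d : ℂ) :
    ContDiffOn ℝ ∞ (fun w => c * a w + d * b w) Ω :=
  (contDiffOn_const.mul ha).add (contDiffOn_const.mul hb)

theorem pd_const_mul_add (hΩ : IsOpen Ω) (hw : w ∈ Ω) (ha : ContDiffOn ℝ ∞ a Ω)
    (hb : ContDiffOn ℝ ∞ b Ω) (c d v : ℂ) :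
    pd v (fun w => c * a w + d * b w) w = c * pd v a w + d * pd v b w := by
  have da := differentiableAt_of_contDiffOn hΩ hw ha
  have db := differentiableAt_of_contDiffOn hΩ hw hb
  exact pd_eq_of_hasDerivAt ((da.const_mul c).add (db.const_mul d))
    (((hasDerivAt_line da v).const_mul c).add ((hasDerivAt_line db v).const_mul d))

theorem pd_ofReal {F : ℂ → ℝ} (hΩ : IsOpen Ω) (hw : w ∈ Ω) (hF : ContDiffOn ℝ ∞ F Ω) (v : ℂ) :
    pd v (fun w => (F w : ℂ)) w = ((pd v F w : ℝ) : ℂ) :=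
  pd_eq_of_hasDerivAt (differentiableAt_of_contDiffOn hΩ hw (contDiffOn_ofReal hF))
    (hasDerivAt_line (differentiableAt_of_contDiffOn hΩ hw hF) v).ofReal_comp

theorem contDiffOn_dz (hΩ : IsOpen Ω) (ha : ContDiffOn ℝ ∞ a Ω) : ContDiffOn ℝ ∞ (dz a) Ω :=
  contDiffOn_const_mul_add (contDiffOn_pd hΩ ha 1) (contDiffOn_pd hΩ ha Complex.I) _ _

theorem contDiffOn_dzbar (hΩ : IsOpen Ω) (ha : ContDiffOn ℝ ∞ a Ω) :
    ContDiffOn ℝ ∞ (dzbar a) Ω :=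
  contDiffOn_const_mul_add (contDiffOn_pd hΩ ha 1) (contDiffOn_pd hΩ ha Complex.I) _ _

theorem pd_dz (hΩ : IsOpen Ω) (hw : w ∈ Ω) (ha : ContDiffOn ℝ ∞ a Ω) (v : ℂ) :
    pd v (dz a) w = 1 / 2 * pd v (pd 1 a) w + -Complex.I / 2 * pd v (pd Complex.I a) w :=
  pd_const_mul_add hΩ hw (contDiffOn_pd hΩ ha 1) (contDiffOn_pd hΩ ha Complex.I) _ _ v

theorem pd_dzbar (hΩ : IsOpen Ω) (hw : w ∈ Ω) (ha : ContDiffOn ℝ ∞ a Ω) (v : ℂ) :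
    pd v (dzbar a) w = 1 / 2 * pd v (pd 1 a) w + Complex.I / 2 * pd v (pd Complex.I a) w :=
  pd_const_mul_add hΩ hw (contDiffOn_pd hΩ ha 1) (contDiffOn_pd hΩ ha Complex.I) _ _ v

end

/-! ### Consequences of vanishing curvature for the immersion. -/

section Immersion

variable {Ω : Set ℂ} {w : ℂ} {X : ℂ → ℂ × ℝ}

/-- Harmonicity together with symmetry of second covariant derivatives is the (anti)holomorphy of
the first derivatives. -/
theorem isHarmonicData (hΩ : IsOpen Ω) (hX : IsConformalImmersion X Ω) (hmin : IsMinimal X Ω) :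
    IsHarmonicData (fun w => (X w).1) (dz fun w => (X w).1) (dzbar fun w => (X w).1)
      (dz fun w => ((X w).2 : ℂ)) Ω := by
  have hs := hX.smooth
  have hh : ContDiffOn ℝ ∞ (fun w => (X w).1) Ω := hs.fst
  have hf : ContDiffOn ℝ ∞ (fun w => (X w).2) Ω := hs.snd
  have hf' := contDiffOn_ofReal hf
  have harm : ∀ w ∈ Ω, covD (fun w => (X w).1) 1 (pd 1 fun w => (X w).1) w
      + covD (fun w => (X w).1) Complex.I (pd Complex.I fun w => (X w).1) w = 0 ∧
      pd 1 (pd 1 fun w => (X w).2) w + pd Complex.I (pd Complex.I fun w => (X w).2) w = 0 := by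
    intro w hw
    have := covDeriv_add_eq_zero hΩ hX hmin hw
    rw [covDeriv_eq hΩ hs hw, covDeriv_eq hΩ hs hw] at this
    exact ⟨congrArg Prod.fst this, congrArg Prod.snd this⟩
  refine ⟨hh, contDiffOn_dz hΩ hh, contDiffOn_dzbar hΩ hh, contDiffOn_dz hΩ hf', hX.mapsTo,
    fun w _ => ?_, fun w _ => ?_, fun w hw => ?_, fun w hw => ?_, fun w hw => ?_, fun w hw => ?_⟩
  · simp only [dz, dzbar]
    ring
  · simp only [dz, dzbar]
    linear_combination pd Complex.I (fun w => (X w).1) w * Complex.I_sq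
  · have e := (harm w hw).1
    simp only [covD] at e ⊢
    rw [pd_dz hΩ hw hh, pd_dz hΩ hw hh, pd_comm hΩ hw hh Complex.I 1, dz]
    linear_combination (-Complex.I / 2) * e
      + (conn (X w).1 * (pd 1 (fun w => (X w).1) w) * pd Complex.I (fun w => (X w).1) w / 2
        + pd 1 (pd Complex.I fun w => (X w).1) w / 2) * Complex.I_sq
  · have e := (harm w hw).1
    simp only [covD] at e ⊢
    rw [pd_dzbar hΩ hw hh, pd_dzbar hΩ hw hh, pd_comm hΩ hw hh Complex.I 1, dzbar]
    linear_combination (Complex.I / 2) * e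
      + (conn (X w).1 * (pd 1 (fun w => (X w).1) w) * pd Complex.I (fun w => (X w).1) w / 2
        + pd 1 (pd Complex.I fun w => (X w).1) w / 2) * Complex.I_sq
  · have e := (harm w hw).2
    have e2 : ∀ u v, pd u (pd v fun w => ((X w).2 : ℂ)) w
        = ((pd u (pd v fun w => (X w).2) w : ℝ) : ℂ) := fun u v => by
      rw [pd_congr hΩ hw (fun w hw => pd_ofReal hΩ hw hf v),
        pd_ofReal hΩ hw (contDiffOn_pd hΩ hf v)]
    rw [pd_dz hΩ hw hf', pd_dz hΩ hw hf', pd_comm hΩ hw hf' Complex.I 1, e2, e2, e2]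
    have e' := congrArg (fun x : ℝ => (x : ℂ)) e
    simp only [Complex.ofReal_add, Complex.ofReal_zero] at e'
    linear_combination (-Complex.I / 2) * e'
      + (((pd 1 (pd Complex.I fun w => (X w).2) w : ℝ) : ℂ) / 2) * Complex.I_sq
  · have hG := hX.equal_length w hw
    have hF := hX.orthogonal w hw
    rw [firstForm_eq hΩ hs hw] at hF hG
    rw [firstForm_eq hΩ hs hw] at hG
    simp only [dz, dzbar, pd_ofReal hΩ hw hf]
    simp only [hypInner] at hF hG
    generalize pd 1 (fun w => (X w).1) w = a at *
    generalize pd Complex.I (fun w => (X w).1) w = b at *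
    generalize pd 1 (fun w => (X w).2) w = c at *
    generalize pd Complex.I (fun w => (X w).2) w = d at *
    generalize sigma (X w).1 = s at *
    -- The complex equation is ⟨X_w, X_w⟩ = 0, extended bilinearly: its real part is E = G and its
    -- imaginary part is F = 0.
    apply Complex.ext
    · simp [sq, map_ofNat, -mul_eq_mul_left_iff, -mul_eq_mul_right_iff] at hF hG ⊢
      linear_combination hG / 4
    · simp [sq, map_ofNat, -mul_eq_mul_left_iff, -mul_eq_mul_right_iff] at hF hG ⊢
      linear_combination -hF / 2

theorem firstForm_eq_energy (hΩ : IsOpen Ω) (hX : IsConformalImmersion X Ω) (hw : w ∈ Ω) :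
    firstForm X w 1 1 = energy (fun w => (X w).1) (dz fun w => (X w).1) (dzbar fun w => (X w).1)
      (dz fun w => ((X w).2 : ℂ)) w := by
  have hs := hX.smooth
  have hG := hX.equal_length w hw
  -- Averaging E and G removes the mixed terms in p, q and in g².
  have e : firstForm X w 1 1 = (firstForm X w 1 1 + firstForm X w Complex.I Complex.I) / 2 := by
    linarith
  rw [e, firstForm_eq hΩ hs hw, firstForm_eq hΩ hs hw]
  simp only [energy, hypInner, dz, dzbar, pd_ofReal hΩ hw hs.snd]
  simp [map_ofNat, -mul_eq_mul_left_iff, -mul_eq_mul_right_iff]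
  ring

/-- The Gauss equation, in the form of an inequality: vanishing Gauss curvature forces the
horizontal Jacobian and one component of the second fundamental form to vanish. -/
theorem jac_eq_zero_of_gaussCurvature (hΩ : IsOpen Ω) (hX : IsConformalImmersion X Ω)
    (hmin : IsMinimal X Ω) (hw : w ∈ Ω) (hK : gaussCurvature X w = 0) :
    jac (fun w => (X w).1) w = 0 ∧
      covD (fun w => (X w).1) 1 (dz fun w => (X w).1) w * dz (fun w => ((X w).2 : ℂ)) w
        = dz (fun w => (X w).1) w * pd 1 (dz fun w => ((X w).2 : ℂ)) w := by
  have H := isHarmonicData hΩ hX hmin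
  have hB := H.bochner hΩ hw
  have hS : ∀ w ∈ Ω, 0 < energy (fun w => (X w).1) (dz fun w => (X w).1)
      (dzbar fun w => (X w).1) (dz fun w => ((X w).2 : ℂ)) w := fun w hw => by
    rw [← firstForm_eq_energy hΩ hX hw]
    exact firstForm_pos hX hw
  have hL := laplacian_log_sqrt hΩ H.contDiffOn_energy hS hw
  have hSw := hS w hw
  have hl : Laplacian.laplacian (fun z => Real.log (inducedFactor X z)) w
      = Laplacian.laplacian (fun w => Real.log (Real.sqrt (energy (fun w => (X w).1)
        (dz fun w => (X w).1) (dzbar fun w => (X w).1) (dz fun w => ((X w).2 : ℂ)) w))) w := by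
    refine (InnerProductSpace.laplacian_congr_nhds ?_).eq_of_nhds
    filter_upwards [hΩ.mem_nhds hw] with z hz
    rw [inducedFactor, firstForm_eq_energy hΩ hX hz]
  have hlam : inducedFactor X w ^ 2 ≠ 0 := by
    have := Real.sqrt_pos.2 (firstForm_pos hX hw)
    rw [inducedFactor]
    positivity
  have hzero : Laplacian.laplacian (fun z => Real.log (inducedFactor X z)) w = 0 := by
    rw [gaussCurvature, conformalCurvature, div_eq_zero_iff, neg_eq_zero] at hK
    exact hK.resolve_right hlam
  rw [hl, hL, div_eq_zero_iff] at hzero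
  have hz := hzero.resolve_right (by positivity)
  -- The Bochner inequality now bounds a sum of two nonnegative terms by 0.
  rw [hz] at hB
  have hsig := sigma_pos (hX.mapsTo w hw)
  set S := energy (fun w => (X w).1) (dz fun w => (X w).1)
      (dzbar fun w => (X w).1) (dz fun w => ((X w).2 : ℂ)) w
  have hn := Complex.normSq_nonneg (covD (fun w => (X w).1) 1 (dz fun w => (X w).1) w
    * dz (fun w => ((X w).2 : ℂ)) w - dz (fun w => (X w).1) w * pd 1 (dz fun w => ((X w).2 : ℂ)) w)
  have t1 : 0 ≤ 2 * S * sigma (X w).1 ^ 4 * jac (fun w => (X w).1) w ^ 2 := by positivity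
  have t2 := mul_nonneg (by positivity : 0 ≤ 8 * sigma (X w).1 ^ 2) hn
  constructor
  · have h0 := le_antisymm (by linarith) t1
    have hc : 2 * S * sigma (X w).1 ^ 4 ≠ 0 := by positivity
    exact pow_eq_zero_iff two_ne_zero |>.1 ((mul_eq_zero.1 h0).resolve_left hc)
  · have h0 := le_antisymm (by linarith) t2
    have hc : 8 * sigma (X w).1 ^ 2 ≠ 0 := by positivity
    exact sub_eq_zero.1 (Complex.normSq_eq_zero.1 ((mul_eq_zero.1 h0).resolve_left hc))

theorem tangentVertical_of_jac_eq_zero (hΩ : IsOpen Ω) (hX : IsConformalImmersion X Ω)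
    (hw : w ∈ Ω) (hj : jac (fun w => (X w).1) w = 0) : TangentVertical X w := by
  have hs := hX.smooth
  have key : ∃ v : ℂ, v ≠ 0 ∧ pd v (fun w => (X w).1) w = 0 := by
    have hlin : ∀ x y : ℝ, pd ⟨x, y⟩ (fun w => (X w).1) w
        = x * pd 1 (fun w => (X w).1) w + y * pd Complex.I (fun w => (X w).1) w := fun x y => by
      have : (⟨x, y⟩ : ℂ) = x • (1 : ℂ) + y • Complex.I := by
        apply Complex.ext <;> simp
      rw [pd, this, map_add, map_smul, map_smul]
      simp [pd]
    by_cases h1 : pd 1 (fun w => (X w).1) w = 0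
    · exact ⟨1, one_ne_zero, h1⟩
    · rw [jac] at hj
      generalize pd 1 (fun w => (X w).1) w = a at *
      generalize pd Complex.I (fun w => (X w).1) w = b at *
      -- With a = h_u ≠ 0 and b = h_v, J = 0 makes \bar a b real, and -(\bar a b)a + (\bar a a)b = 0
      -- is the dependence that gives the kernel vector.
      refine ⟨⟨-(conj a * b).re, Complex.normSq a⟩, fun h => h1 ?_, ?_⟩
      · exact Complex.normSq_eq_zero.1 (congrArg Complex.im h)
      · rw [hlin]
        have e : conj a * b = ((conj a * b).re : ℂ) := by
          apply Complex.ext <;> simp [hj]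
        rw [Complex.ofReal_neg, ← e, Complex.normSq_eq_conj_mul_self]
        ring
  obtain ⟨v, hv, h0⟩ := key
  have hne := fderiv_ne_zero hX hw hv
  have hv2 := fderiv_apply_eq hΩ hs hw v
  rw [h0] at hv2
  have h2 : pd v (fun w => (X w).2) w ≠ 0 := fun h => hne (by rw [hv2, h]; rfl)
  refine ⟨(pd v (fun w => (X w).2) w)⁻¹ • v, ?_⟩
  rw [map_smul, hv2]
  simp [h2]

end Immersion

/-! ### Explicit geodesics of the disc. -/

section Geodesic

/-- The geodesic of the disc that corresponds to `(c β cosh s + i β sinh s, b cosh s)` in the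
hyperboloid model, where `b² = 1 + c²`. -/
def geodesicCurve (β : ℂ) (b c s : ℝ) : ℂ :=
  β * (c * Real.cosh s + Complex.I * Real.sinh s) / (1 + b * Real.cosh s)

/-- Velocity of `geodesicCurve`. -/
def geodesicVelocity (β : ℂ) (b c s : ℝ) : ℂ :=
  β * (c * Real.sinh s + Complex.I * (Real.cosh s + b)) / (1 + b * Real.cosh s) ^ 2

variable {β : ℂ} {b c : ℝ} (hβ : ‖β‖ = 1) (hb : 0 < b) (hbc : b ^ 2 = 1 + c ^ 2)

theorem hasDerivAt_ofReal_cosh (s : ℝ) :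
    HasDerivAt (fun s : ℝ => (Real.cosh s : ℂ)) (Real.sinh s : ℂ) s :=
  (Real.hasDerivAt_cosh s).ofReal_comp

theorem hasDerivAt_ofReal_sinh (s : ℝ) :
    HasDerivAt (fun s : ℝ => (Real.sinh s : ℂ)) (Real.cosh s : ℂ) s :=
  (Real.hasDerivAt_sinh s).ofReal_comp

include hb in
theorem one_add_mul_cosh_pos (s : ℝ) : 0 < 1 + b * Real.cosh s := by
  have := Real.cosh_pos s
  positivity

include hb in
theorem one_add_mul_cosh_ne (s : ℝ) : (1 + (b : ℂ) * (Real.cosh s : ℂ)) ≠ 0 := by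
  exact_mod_cast (one_add_mul_cosh_pos hb s).ne'

include hb in
theorem norm_one_add_mul_cosh (s : ℝ) :
    ‖(1 + (b : ℂ) * (Real.cosh s : ℂ))‖ = 1 + b * Real.cosh s := by
  have e : (1 + (b : ℂ) * (Real.cosh s : ℂ)) = ((1 + b * Real.cosh s : ℝ) : ℂ) := by
    push_cast
    rfl
  rw [e, Complex.norm_real, Real.norm_of_nonneg (one_add_mul_cosh_pos hb s).le]

theorem ofReal_cosh_sq (s : ℝ) : (Real.cosh s : ℂ) ^ 2 = 1 + (Real.sinh s : ℂ) ^ 2 := by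
  exact_mod_cast (Real.cosh_sq' s)

include hb in
theorem hasDerivAt_geodesicCurve (s : ℝ) :
    HasDerivAt (geodesicCurve β b c) (geodesicVelocity β b c s) s := by
  have h0 := one_add_mul_cosh_ne hb s
  have hn := (((hasDerivAt_ofReal_cosh s).const_mul (c : ℂ)).add
    ((hasDerivAt_ofReal_sinh s).const_mul Complex.I)).const_mul β
  have hd := ((hasDerivAt_ofReal_cosh s).const_mul (b : ℂ)).const_add 1
  refine (hn.div hd h0).congr_deriv ?_
  simp only [Pi.add_apply, geodesicVelocity]
  rw [div_left_inj' (pow_ne_zero 2 h0)]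
  linear_combination (β * Complex.I * b) * ofReal_cosh_sq s

include hb in
theorem hasDerivAt_geodesicVelocity (s : ℝ) :
    HasDerivAt (geodesicVelocity β b c)
      (β * ((c * Real.cosh s + Complex.I * Real.sinh s) * (1 + b * Real.cosh s)
        - 2 * b * Real.sinh s * (c * Real.sinh s + Complex.I * (Real.cosh s + b)))
        / (1 + b * Real.cosh s) ^ 3) s := by
  have h0 := one_add_mul_cosh_ne hb s
  have hn := (((hasDerivAt_ofReal_sinh s).const_mul (c : ℂ)).add
    (((hasDerivAt_ofReal_cosh s).add_const (b : ℂ)).const_mul Complex.I)).const_mul β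
  have hd := (((hasDerivAt_ofReal_cosh s).const_mul (b : ℂ)).const_add 1).pow 2
  refine (hn.div hd (pow_ne_zero 2 h0)).congr_deriv ?_
  simp only [Pi.add_apply, Pi.pow_apply]
  generalize (1 + (b : ℂ) * (Real.cosh s : ℂ)) = W at *
  field_simp
  push_cast
  ring

include hb in
theorem contDiff_geodesicCurve : ContDiff ℝ ∞ (geodesicCurve β b c) := by
  have hc : ContDiff ℝ ∞ (fun s : ℝ => (Real.cosh s : ℂ)) :=
    Complex.ofRealCLM.contDiff.comp Real.contDiff_cosh
  have hs : ContDiff ℝ ∞ (fun s : ℝ => (Real.sinh s : ℂ)) :=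
    Complex.ofRealCLM.contDiff.comp Real.contDiff_sinh
  have hd : ContDiff ℝ ∞ (fun s : ℝ => 1 + (b : ℂ) * (Real.cosh s : ℂ)) :=
    contDiff_const.add (contDiff_const.mul hc)
  exact (contDiff_const.mul ((contDiff_const.mul hc).add (contDiff_const.mul hs))).mul
    (hd.inv (one_add_mul_cosh_ne hb))

-- Stereographic projection sends the hyperboloid point (Y, T) to Y/(1 + T), so 1 - |z|² = 2/(1 +
-- T), here with T = b cosh s.
include hβ hb hbc in
theorem one_sub_norm_sq_geodesicCurve (s : ℝ) :
    1 - ‖geodesicCurve β b c s‖ ^ 2 = 2 / (1 + b * Real.cosh s) := by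
  have h0 := one_add_mul_cosh_pos hb s
  have e : ‖(c * Real.cosh s + Complex.I * Real.sinh s : ℂ)‖ ^ 2
      = (c * Real.cosh s) ^ 2 + Real.sinh s ^ 2 := by
    rw [Complex.sq_norm, Complex.normSq_apply]
    simp [-Complex.ofReal_cosh, -Complex.ofReal_sinh]
    ring
  have e2 := norm_one_add_mul_cosh hb s
  rw [geodesicCurve, norm_div, norm_mul, hβ, one_mul, div_pow, e, e2]
  field_simp
  linear_combination Real.cosh s ^ 2 * hbc + Real.cosh_sq' s

include hβ hb hbc in
theorem isGeodesic_range_geodesicCurve : IsGeodesic (Set.range (geodesicCurve β b c)) := by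
  have hd1 : deriv (geodesicCurve β b c) = geodesicVelocity β b c :=
    funext fun s => (hasDerivAt_geodesicCurve hb s).deriv
  have hsig : ∀ s, sigma (geodesicCurve β b c s) = 1 + b * Real.cosh s := fun s => by
    have h0 := (one_add_mul_cosh_pos hb s).ne'
    rw [sigma, one_sub_norm_sq_geodesicCurve hβ hb hbc]
    field_simp
  refine ⟨geodesicCurve β b c, contDiff_geodesicCurve hb, fun s => ?_, fun s => ?_, fun s => ?_,
    rfl⟩
  · have h1 : 0 < 1 - ‖geodesicCurve β b c s‖ ^ 2 := by
      rw [one_sub_norm_sq_geodesicCurve hβ hb hbc]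
      exact div_pos two_pos (one_add_mul_cosh_pos hb s)
    have : ‖geodesicCurve β b c s‖ < 1 := by
      rw [← sq_lt_one_iff₀ (norm_nonneg _)]
      linarith
    simpa [disc] using this
  · have h0 := one_add_mul_cosh_pos hb s
    rw [hd1, hsig, geodesicVelocity, norm_div, norm_mul, hβ, one_mul, norm_pow]
    have e2 := norm_one_add_mul_cosh hb s
    have e : ‖(c * Real.sinh s + Complex.I * (Real.cosh s + b) : ℂ)‖ = 1 + b * Real.cosh s := by
      rw [← sq_eq_sq₀ (norm_nonneg _) h0.le, Complex.sq_norm, Complex.normSq_apply]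
      simp [-Complex.ofReal_cosh, -Complex.ofReal_sinh]
      linear_combination (1 - Real.cosh s ^ 2) * hbc - c ^ 2 * Real.cosh_sq' s
    rw [e, e2]
    field_simp
  · have h0 := one_add_mul_cosh_ne hb s
    rw [hd1, (hasDerivAt_geodesicVelocity hb s).deriv, christoffelDisc]
    have e : (1 - (‖geodesicCurve β b c s‖ : ℂ) ^ 2) = 2 / (1 + b * Real.cosh s) := by
      exact_mod_cast congrArg (fun x : ℝ => (x : ℂ)) (one_sub_norm_sq_geodesicCurve hβ hb hbc s)
    have hββ : conj β * β = 1 := by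
      rw [Complex.conj_mul', hβ]
      norm_num
    have hbc' : (b : ℂ) ^ 2 = 1 + (c : ℂ) ^ 2 := by exact_mod_cast hbc
    have hcs := ofReal_cosh_sq s
    -- The acceleration has denominator W³ and the Christoffel term W⁴, where W = 1 + b cosh s; this
    -- factorization supplies the missing W.
    have key : ((c : ℂ) * Real.cosh s - Complex.I * Real.sinh s)
        * (c * Real.sinh s + Complex.I * (Real.cosh s + b))
        = (1 + b * Real.cosh s) * (b * Real.sinh s + Complex.I * c) := by
      linear_combination (-Real.cosh s * Real.sinh s : ℂ) * hbc' + Complex.I * c * hcs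
        - (Real.sinh s * (Real.cosh s + b) : ℂ) * Complex.I_sq
    rw [e, geodesicCurve, geodesicVelocity, map_div₀]
    simp only [map_mul, map_add, Complex.conj_I, Complex.conj_ofReal, map_one]
    generalize (Real.cosh s : ℂ) = C at *
    generalize (Real.sinh s : ℂ) = S at *
    generalize hW : 1 + (b : ℂ) * C = W at *
    field_simp
    subst hW
    linear_combination (β * (c * C - Complex.I * S) * (c * S + Complex.I * (C + b)) ^ 2) * hββ
      + β * (c * S + Complex.I * (C + b)) * key
      + β * (1 + b * C) * (-Complex.I * S * hbc' + b * c * hcs)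
      + β * (1 + b * C) * c * (C + b) * Complex.I_sq

/-- A line of the Klein model, seen in the Poincaré disc, is a geodesic. -/
theorem exists_isGeodesic (B : ℂ) (c : ℝ) (hB : Complex.normSq B = 1 + c ^ 2) :
    ∃ Γ, IsGeodesic Γ ∧ ∀ z ∈ disc, 2 * (conj z * B).re = c * (1 + ‖z‖ ^ 2) → z ∈ Γ := by
  have hb : 0 < ‖B‖ := by
    rw [norm_pos_iff]
    rintro rfl
    have : 0 < 1 + c ^ 2 := by positivity
    simp at hB
    linarith
  have hbc : ‖B‖ ^ 2 = 1 + c ^ 2 := by rw [Complex.sq_norm, hB]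
  have hβ : ‖B / ‖B‖‖ = 1 := by
    rw [norm_div, Complex.norm_real, norm_norm, div_self hb.ne']
  refine ⟨_, isGeodesic_range_geodesicCurve hβ hb hbc, fun z hz hzB => ?_⟩
  have hB0 : (‖B‖ : ℂ) ≠ 0 := by exact_mod_cast hb.ne'
  set β := B / ‖B‖ with hβdef
  have hBβ : B = β * ‖B‖ := by rw [hβdef, div_mul_cancel₀ _ hB0]
  generalize ‖B‖ = b at *
  have hββ : β * conj β = 1 := by
    rw [Complex.mul_conj', hβ]
    norm_num
  -- A rotation reduces to the case where B is a positive real number.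
  obtain ⟨u, rfl⟩ : ∃ u, z = β * u := ⟨conj β * z, by rw [← mul_assoc, hββ, one_mul]⟩
  obtain ⟨x, y⟩ := u
  have hD := one_sub_norm_sq_pos hz
  have hn : ‖β * ⟨x, y⟩‖ ^ 2 = x ^ 2 + y ^ 2 := by
    rw [norm_mul, hβ, one_mul, Complex.sq_norm, Complex.normSq_mk]
    ring
  rw [hn] at hD hzB
  have hx : 2 * b * x = c * (1 + (x ^ 2 + y ^ 2)) := by
    rw [← hzB, hBβ, map_mul]
    have : conj β * conj (⟨x, y⟩ : ℂ) * (β * b) = conj (⟨x, y⟩ : ℂ) * b := by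
      linear_combination (conj (⟨x, y⟩ : ℂ) * b) * hββ
    rw [this]
    simp
    ring
  set D := 1 - (x ^ 2 + y ^ 2) with hDdef
  -- The hyperboloid point of u has coordinates 2x/D, 2y/D and (1 + |u|²)/D, to be matched with c
  -- cosh s, sinh s and b cosh s.
  refine ⟨Real.arsinh (2 * y / D), ?_⟩
  have hcosh : Real.cosh (Real.arsinh (2 * y / D)) = (1 + (x ^ 2 + y ^ 2)) / (b * D) := by
    rw [Real.cosh_arsinh, ← Real.sqrt_sq (by positivity : 0 ≤ (1 + (x ^ 2 + y ^ 2)) / (b * D))]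
    congr 1
    field_simp
    rw [hDdef]
    linear_combination (-(2 * b * x) - c * (1 + (x ^ 2 + y ^ 2))) * hx
      + (1 + (x ^ 2 + y ^ 2)) ^ 2 * hbc
  have h1 : 1 + b * ((1 + (x ^ 2 + y ^ 2)) / (b * D)) = 2 / D := by
    field_simp
    rw [hDdef]
    ring
  have h2 : c * ((1 + (x ^ 2 + y ^ 2)) / (b * D)) = 2 * x / D := by
    field_simp
    linear_combination -hx
  rw [geodesicCurve, Real.sinh_arsinh, hcosh, ← Complex.ofReal_mul, ← Complex.ofReal_mul,
    ← Complex.ofReal_one, ← Complex.ofReal_add, h1, h2]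
  have hDc : (D : ℂ) ≠ 0 := by exact_mod_cast hD.ne'
  have : (⟨x, y⟩ : ℂ) = x + Complex.I * y := by
    apply Complex.ext <;> simp
  rw [this]
  push_cast
  field_simp

end Geodesic

/-! ### Tangent vectors in the hyperboloid model. -/

/-- Time component of the vector of the hyperboloid model that corresponds to the tangent vector
`n` of the disc at `z`. -/
def lorentzTime (z n : ℂ) : ℝ := 4 * (conj z * n).re / (1 - ‖z‖ ^ 2) ^ 2

/-- Space component of the vector of the hyperboloid model that corresponds to the tangent vector
`n` of the disc at `z`. -/
def lorentzSpace (z n : ℂ) : ℂ := 2 * n / ((1 - ‖z‖ ^ 2 : ℝ) : ℂ) + (lorentzTime z n : ℂ) * z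

/-- The passage to the hyperboloid is an isometry, so a unit tangent vector becomes a unit spacelike
vector. -/
theorem normSq_lorentzSpace {z n : ℂ} (hz : z ∈ disc) (hn : sigma z ^ 2 * Complex.normSq n = 1) :
    Complex.normSq (lorentzSpace z n) = 1 + lorentzTime z n ^ 2 := by
  have hD := (one_sub_norm_sq_pos hz).ne'
  rw [lorentzSpace, Complex.normSq_add, Complex.normSq_div, Complex.normSq_mul,
    Complex.normSq_mul, Complex.normSq_ofReal, Complex.normSq_ofReal]
  rw [sigma] at hn
  have hz2 : ‖z‖ ^ 2 = Complex.normSq z := Complex.sq_norm z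
  have e : (2 * n / ((1 - ‖z‖ ^ 2 : ℝ) : ℂ) * conj ((lorentzTime z n : ℂ) * z)).re
      = 2 * lorentzTime z n * (conj z * n).re / (1 - ‖z‖ ^ 2) := by
    rw [div_mul_eq_mul_div, Complex.div_ofReal_re]
    congr 1
    simp
    ring
  rw [e, ← hz2, lorentzTime]
  generalize (conj z * n).re = m
  have h2 : Complex.normSq 2 = 4 := by
    rw [← Complex.sq_norm]
    norm_num
  rw [h2]
  generalize hD' : 1 - ‖z‖ ^ 2 = D at *
  have hz' : ‖z‖ ^ 2 = 1 - D := by linarith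
  have hn' : Complex.normSq n = D ^ 2 / 4 := by
    field_simp at hn
    linarith
  rw [hz', hn']
  field_simp
  ring

/-- A tangent vector of the hyperboloid is Lorentz-orthogonal to its base point (2z, 1 + |z|²)/(1 -
|z|²). -/
theorem re_conj_mul_lorentzSpace {z n : ℂ} (hz : z ∈ disc) :
    2 * (conj z * lorentzSpace z n).re = lorentzTime z n * (1 + ‖z‖ ^ 2) := by
  have hD := (one_sub_norm_sq_pos hz).ne'
  have e : conj z * lorentzSpace z n
      = ((2 / (1 - ‖z‖ ^ 2) : ℝ) : ℂ) * (conj z * n) + ((lorentzTime z n * ‖z‖ ^ 2 : ℝ) : ℂ) := by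
    have hz2 : conj z * z = ((‖z‖ ^ 2 : ℝ) : ℂ) := by
      rw [Complex.conj_mul']
      push_cast
      rfl
    rw [Complex.ofReal_mul, ← hz2, lorentzSpace, Complex.ofReal_div, Complex.ofReal_ofNat]
    ring
  rw [e, Complex.add_re, Complex.ofReal_re, Complex.re_ofReal_mul, lorentzTime]
  generalize (conj z * n).re = m
  generalize hD' : 1 - ‖z‖ ^ 2 = D at *
  have : ‖z‖ ^ 2 = 1 - D := by linarith
  rw [this]
  field_simp
  ring

section Parallel

variable {z n : ℝ → ℂ} {z' n' : ℂ} {t : ℝ}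

/-- A parallel normal field along a curve of the disc has constant time component in the
hyperboloid model. -/
theorem hasDerivAt_lorentzTime (hz : HasDerivAt z z' t) (hn : HasDerivAt n n' t)
    (hd : z t ∈ disc) (hpar : n' + conn (z t) * z' * n t = 0) (hperp : (z' * conj (n t)).re = 0) :
    HasDerivAt (fun t => lorentzTime (z t) (n t)) 0 t := by
  have hD := (one_sub_norm_sq_pos hd).ne'
  have h := ((hasDerivAt_re ((hasDerivAt_conj hz).mul hn)).const_mul 4).div
    ((hasDerivAt_one_sub_norm_sq hz).pow 2) (by simpa using pow_ne_zero 2 hD)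
  refine h.congr_deriv ?_
  have e : conn (z t) = ((2 / (1 - ‖z t‖ ^ 2) : ℝ) : ℂ) * conj (z t) := by
    simp only [conn]
    push_cast
    ring
  rw [eq_neg_of_add_eq_zero_left hpar, e]
  simp only [Pi.mul_apply, Pi.pow_apply]
  generalize 1 - ‖z t‖ ^ 2 = D at *
  generalize z t = x at *
  generalize n t = y at *
  simp only [Complex.mul_re, Complex.mul_im, Complex.add_re, Complex.conj_re, Complex.conj_im,
    Complex.neg_re, Complex.neg_im, Complex.ofReal_re, Complex.ofReal_im] at hperp ⊢
  field_simp
  linear_combination D * (8 * x.re ^ 2 + 4 * D + 8 * x.im ^ 2) * hperp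

/-- A parallel normal field along a curve of the disc has constant space component in the
hyperboloid model. -/
theorem hasDerivAt_lorentzSpace (hz : HasDerivAt z z' t) (hn : HasDerivAt n n' t)
    (hd : z t ∈ disc) (hpar : n' + conn (z t) * z' * n t = 0) (hperp : (z' * conj (n t)).re = 0) :
    HasDerivAt (fun t => lorentzSpace (z t) (n t)) 0 t := by
  have hD := (one_sub_norm_sq_pos hd).ne'
  have h := ((hn.const_mul 2).div (hasDerivAt_one_sub_norm_sq hz).ofReal_comp
    (by exact_mod_cast hD)).add
    ((hasDerivAt_lorentzTime hz hn hd hpar hperp).ofReal_comp.mul hz)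
  refine h.congr_deriv ?_
  have e : conn (z t) = 2 * conj (z t) / ((1 - ‖z t‖ ^ 2 : ℝ) : ℂ) := by
    simp only [conn]
    push_cast
    rfl
  have hDc : ((1 - ‖z t‖ ^ 2 : ℝ) : ℂ) ≠ 0 := by exact_mod_cast hD
  rw [eq_neg_of_add_eq_zero_left hpar, e]
  have e1 : ((-2 * (z' * conj (z t)).re : ℝ) : ℂ) = -(z' * conj (z t) + conj z' * z t) := by
    have := Complex.re_eq_add_conj (z' * conj (z t))
    push_cast
    rw [this]
    simp
    ring
  have e2 : (((conj (z t) * n t).re : ℝ) : ℂ) = (conj (z t) * n t + z t * conj (n t)) / 2 := by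
    rw [Complex.re_eq_add_conj]
    simp
  have e3 : z' * conj (n t) + conj z' * n t = 0 := by
    have := Complex.re_eq_add_conj (z' * conj (n t))
    rw [hperp] at this
    simp at this
    linear_combination (-2) * this
  rw [e1, lorentzTime, Complex.ofReal_div, Complex.ofReal_mul, Complex.ofReal_pow, e2]
  generalize ((1 - ‖z t‖ ^ 2 : ℝ) : ℂ) = D at *
  simp
  field_simp
  linear_combination 4 * z t * e3

end Parallel

/-! ### A parallel unit normal confines the map to a geodesic. -/

section Rigidity

variable {Ω : Set ℂ} {h p q g : ℂ → ℂ}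

theorem IsHarmonicData.exists_isGeodesic (H : IsHarmonicData h p q g Ω) (hΩ : IsOpen Ω)
    (hΩc : IsConnected Ω) (hpos : ∀ w ∈ Ω, 0 < energy h p q g w) (hj : ∀ w ∈ Ω, jac h w = 0)
    (hA : ∀ w ∈ Ω, covD h 1 p w * g w = p w * pd 1 g w) :
    ∃ Γ, IsGeodesic Γ ∧ ∀ w ∈ Ω, h w ∈ Γ := by
  have hpq : ∀ w ∈ Ω, Complex.normSq (p w) = Complex.normSq (q w) := fun w hw =>
    sub_eq_zero.1 ((H.jac_eq hw).symm.trans (hj w hw))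
  -- At a zero of g, conformality kills p or q, hence both since |p| = |q|, contradicting S > 0.
  have hg : ∀ w ∈ Ω, g w ≠ 0 := fun w hw h0 => by
    have hs : (sigma (h w) : ℂ) ≠ 0 := by exact_mod_cast (sigma_pos (H.mapsTo w hw)).ne'
    have hc := H.conformal w hw
    have hq0 : p w = 0 ∧ q w = 0 := by
      have e := hpq w hw
      rcases eq_or_ne (p w) 0 with hp | hp
      · rw [hp, map_zero] at e
        exact ⟨hp, Complex.normSq_eq_zero.1 e.symm⟩
      · have : q w = 0 := by simpa [h0, hs, hp] using hc
        exact absurd (Complex.normSq_eq_zero.1 (by rw [e, this, map_zero])) hp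
    have := hpos w hw
    simp [energy, hypInner, h0, hq0] at this
  have hgp : ∀ w ∈ Ω, Complex.normSq (g w) = sigma (h w) ^ 2 * Complex.normSq (p w) := by
    intro w hw
    have e := congrArg Complex.normSq (H.conformal w hw)
    simp only [map_pow, map_mul, Complex.normSq_neg, Complex.normSq_conj, Complex.normSq_ofReal,
      ← hpq w hw] at e
    rw [← sq_eq_sq₀ (Complex.normSq_nonneg _) 
      (mul_nonneg (sq_nonneg _) (Complex.normSq_nonneg _)), e]
    ring
  set N : ℂ → ℂ := fun w => p w * (g w)⁻¹ with hN
  have hNs : ContDiffOn ℝ ∞ N Ω := H.smooth_p.mul (H.smooth_g.inv hg)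
  have hunit : ∀ w ∈ Ω, sigma (h w) ^ 2 * Complex.normSq (N w) = 1 := fun w hw => by
    have h0 : Complex.normSq (g w) ≠ 0 := fun h => hg w hw (Complex.normSq_eq_zero.1 h)
    rw [hN, map_mul, map_inv₀, ← mul_assoc, ← hgp w hw, mul_inv_cancel₀ h0]
  have hpdN : ∀ w ∈ Ω, ∀ v, pd v N w = (pd v p w * g w - p w * pd v g w) / g w ^ 2 := by
    intro w hw v
    have D := @differentiableAt_of_contDiffOn ℂ _ _ Ω w hΩ hw
    refine (pd_eq_of_hasDerivAt (D hNs) ((hasDerivAt_line (D H.smooth_p) v).mul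
      ((hasDerivAt_line (D H.smooth_g) v).inv (by simpa using hg w hw)))).trans ?_
    have := hg w hw
    simp only [zero_smul, add_zero]
    field_simp
    ring
  have hpar1 : ∀ w ∈ Ω, pd 1 N w + conn (h w) * pd 1 h w * N w = 0 := fun w hw => by
    have h0 := hg w hw
    have e := hA w hw
    rw [covD] at e
    rw [hpdN w hw, hN]
    field_simp
    linear_combination e
  -- N is a quotient of holomorphic sections, so being parallel in the direction 1 forces it in the
  -- direction i.
  have hparI : ∀ w ∈ Ω, pd Complex.I N w + conn (h w) * pd Complex.I h w * N w = 0 := by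
    intro w hw
    have h0 := hg w hw
    have e := H.covD_p w hw
    rw [covD] at e
    rw [hpdN w hw, hN, H.pd_g w hw]
    field_simp
    linear_combination g w * e + Complex.I * hA w hw
  -- Both right-hand sides are purely imaginary, which is the orthogonality of N to h_u and h_v.
  have hqN : ∀ w ∈ Ω, pd 1 h w * conj (N w) = (g w - conj (g w)) / (sigma (h w) : ℂ) ^ 2 ∧
      pd Complex.I h w * conj (N w) = Complex.I * (g w + conj (g w)) / (sigma (h w) : ℂ) ^ 2 := by
    intro w hw
    have hs : (sigma (h w) : ℂ) ≠ 0 := by exact_mod_cast (sigma_pos (H.mapsTo w hw)).ne'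
    have h0 := hg w hw
    have h0' : conj (g w) ≠ 0 := by simpa using h0
    have e1 : g w * conj (g w) = (sigma (h w) : ℂ) ^ 2 * (p w * conj (p w)) := by
      rw [Complex.mul_conj, Complex.mul_conj, hgp w hw]
      push_cast
      rfl
    have e2 := congrArg conj (H.conformal w hw)
    simp only [map_pow, map_neg, map_mul, Complex.conj_conj, Complex.conj_ofReal] at e2
    rw [H.pd_one w hw, H.pd_I w hw, hN]
    simp only [map_mul, map_inv₀]
    constructor
    · field_simp
      linear_combination -e1 + e2
    · field_simp
      linear_combination -e1 - e2
  have hperp1 : ∀ w ∈ Ω, (pd 1 h w * conj (N w)).re = 0 := fun w hw => by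
    rw [(hqN w hw).1, ← Complex.ofReal_pow, Complex.div_ofReal_re]
    simp
  have hperpI : ∀ w ∈ Ω, (pd Complex.I h w * conj (N w)).re = 0 := fun w hw => by
    rw [(hqN w hw).2, ← Complex.ofReal_pow, Complex.div_ofReal_re]
    simp
  have hts : ContDiffOn ℝ ∞ (fun w => lorentzTime (h w) (N w)) Ω :=
    (contDiffOn_const.mul (contDiffOn_re ((contDiffOn_conj H.smooth).mul hNs))).div
      ((contDiffOn_one_sub_norm_sq H.smooth).pow 2)
      fun w hw => pow_ne_zero 2 (one_sub_norm_sq_pos (H.mapsTo w hw)).ne'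
  have hss : ContDiffOn ℝ ∞ (fun w => lorentzSpace (h w) (N w)) Ω :=
    ((contDiffOn_const.mul hNs).mul
      ((contDiffOn_ofReal (contDiffOn_one_sub_norm_sq H.smooth)).inv fun w hw => by
        exact_mod_cast (one_sub_norm_sq_pos (H.mapsTo w hw)).ne')).add
      ((contDiffOn_ofReal hts).mul H.smooth)
  have dh := fun w (hw : w ∈ Ω) => differentiableAt_of_contDiffOn hΩ hw H.smooth
  have dN := fun w (hw : w ∈ Ω) => differentiableAt_of_contDiffOn hΩ hw hNs
  -- The Minkowski vector (B, c) of N is constant on the connected domain; it is the normal of the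
  -- plane containing the image of h.
  obtain ⟨c, hc⟩ := eq_of_pd_eq_zero hΩ hΩc (hts.differentiableOn (by simp))
    (fun w hw => pd_eq_of_hasDerivAt (differentiableAt_of_contDiffOn hΩ hw hts)
      (hasDerivAt_lorentzTime (hasDerivAt_line (dh w hw) 1) (hasDerivAt_line (dN w hw) 1)
        (by simpa using H.mapsTo w hw) (by simpa using hpar1 w hw) (by simpa using hperp1 w hw)))
    (fun w hw => pd_eq_of_hasDerivAt (differentiableAt_of_contDiffOn hΩ hw hts)
      (hasDerivAt_lorentzTime (hasDerivAt_line (dh w hw) _) (hasDerivAt_line (dN w hw) _)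
        (by simpa using H.mapsTo w hw) (by simpa using hparI w hw) (by simpa using hperpI w hw)))
  obtain ⟨B, hB⟩ := eq_of_pd_eq_zero hΩ hΩc (hss.differentiableOn (by simp))
    (fun w hw => pd_eq_of_hasDerivAt (differentiableAt_of_contDiffOn hΩ hw hss)
      (hasDerivAt_lorentzSpace (hasDerivAt_line (dh w hw) 1) (hasDerivAt_line (dN w hw) 1)
        (by simpa using H.mapsTo w hw) (by simpa using hpar1 w hw) (by simpa using hperp1 w hw)))
    (fun w hw => pd_eq_of_hasDerivAt (differentiableAt_of_contDiffOn hΩ hw hss)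
      (hasDerivAt_lorentzSpace (hasDerivAt_line (dh w hw) _) (hasDerivAt_line (dN w hw) _)
        (by simpa using H.mapsTo w hw) (by simpa using hparI w hw) (by simpa using hperpI w hw)))
  obtain ⟨w₀, hw₀⟩ := hΩc.nonempty
  have hBc := normSq_lorentzSpace (H.mapsTo w₀ hw₀) (hunit w₀ hw₀)
  rw [hB w₀ hw₀, hc w₀ hw₀] at hBc
  obtain ⟨Γ, hΓ, hmem⟩ := H2R.exists_isGeodesic B c hBc
  refine ⟨Γ, hΓ, fun w hw => hmem _ (H.mapsTo w hw) ?_⟩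
  have := re_conj_mul_lorentzSpace (n := N w) (H.mapsTo w hw)
  rwa [hB w hw, hc w hw] at this

end Rigidity

end H2R

end

theorem mainTheorem6 (Ω : Set ℂ) (hΩ : IsOpen Ω) (hΩc : IsConnected Ω)
    (X : ℂ → ℂ × ℝ) (hX : H2R.IsConformalImmersion X Ω) (hmin : H2R.IsMinimal X Ω) :
    (∀ w ∈ Ω, H2R.gaussCurvature X w = 0 → H2R.TangentVertical X w) ∧
    ((∀ w ∈ Ω, H2R.gaussCurvature X w = 0) →
      ∃ Γ : Set ℂ, H2R.IsGeodesic Γ ∧ X '' Ω ⊆ Γ ×ˢ (Set.univ : Set ℝ)) := by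
  refine ⟨fun w hw hK => H2R.tangentVertical_of_jac_eq_zero hΩ hX hw
    (H2R.jac_eq_zero_of_gaussCurvature hΩ hX hmin hw hK).1, fun hK => ?_⟩
  obtain ⟨Γ, hΓ, hmem⟩ := (H2R.isHarmonicData hΩ hX hmin).exists_isGeodesic hΩ hΩc
    (fun w hw => by
      rw [← H2R.firstForm_eq_energy hΩ hX hw]
      exact H2R.firstForm_pos hX hw)
    (fun w hw => (H2R.jac_eq_zero_of_gaussCurvature hΩ hX hmin hw (hK w hw)).1)
    (fun w hw => (H2R.jac_eq_zero_of_gaussCurvature hΩ hX hmin hw (hK w hw)).2)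
  refine ⟨Γ, hΓ, ?_⟩
  rintro _ ⟨w, hw, rfl⟩
  exact ⟨hmem w hw, Set.mem_univ _⟩
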